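/- All graphs are finite, simple and undirected; $V(G)$ and $E(G)$ are the vertex set and the edge set of $G$, and $G+P_1$ is the join of $G$ with a one-vertex graph, i.e. $G$ together with one new vertex adjacent to all vertices of $G$. A drawing represents vertices by distinct points of the plane and each edge by a simple (polygonal) arc between its endvertices that passes through no other vertex; any point common to the interiors of two edges is a proper crossing. A 1-planar drawing is a drawing in which every edge is crossed at most once and adjacent edges do not cross. For a 1-planar drawing $D$, let $D^\times$ be the associated plane graph, obtained by turning every crossing into a new vertex of degree four (a false vertex). A graph is of class $\mathcal C_0$ if it has a 1-planar drawing $D$ in which $N_{D^\times}(c_1)\cap N_{D^\times}(c_2)=\emptyset$ for any two distinct false vertices $c_1,c_2$. It is of class $\mathcal C_1$ if it is not of class $\mathcal C_0$ and has a 1-planar drawing $D$ in which $|N_{D^\times}(c_1)\cap N_{D^\times}(c_2)|\le 1$ for any two distinct false vertices $c_1,c_2$. Lemma. (a) If $G+P_1$ is of class $\mathcal C_1$, then $|E(G)|\le 2.6\,|V(G)|-3.6$. (b) For every integer $k\ge 2$ there is a graph $G_k$ with $|V(G_k)|=5k+2$ and $|E(G_k)|=12k+1=2.4\,|V(G_k)|-3.8$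 such that $G_k+P_1$ is of class $\mathcal C_1$. -/

import Mathlib

open Set Filter Topology

namespace OnePlanar

/-- The Euclidean plane, in coordinates. -/
abbrev Plane : Type := ℝ × ℝ

/-- A (simple) polygonal arc: the straight segments from `pt i` to `pt (i + 1)`, for `i < len`,
are non-degenerate, consecutive ones meet exactly in their common end, and any two others are
disjoint. Only the values `pt 0, …, pt len` matter. -/
structure PolygonalArc where
  len : ℕ
  len_pos : 0 < len
  pt : ℕ → Plane
  pt_ne : ∀ i < len, pt i ≠ pt (i + 1)
  consecutive : ∀ i, i + 1 < len →
    segment ℝ (pt i) (pt (i + 1)) ∩ segment ℝ (pt (i + 1)) (pt (i + 2)) = {pt (i + 1)}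
  far : ∀ i j, i + 1 < j → j < len →
    Disjoint (segment ℝ (pt i) (pt (i + 1))) (segment ℝ (pt j) (pt (j + 1)))

namespace PolygonalArc

/-- The first endpoint of the arc. -/
def source (A : PolygonalArc) : Plane := A.pt 0

/-- The last endpoint of the arc. -/
def target (A : PolygonalArc) : Plane := A.pt A.len

/-- The set of points of the arc. -/
def carrier (A : PolygonalArc) : Set Plane :=
  ⋃ i ∈ Finset.range A.len, segment ℝ (A.pt i) (A.pt (i + 1))

/-- The points of the arc other than its two endpoints. -/
def inner (A : PolygonalArc) : Set Plane := A.carrier \ {A.source, A.target}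

end PolygonalArc

/-- `B` passes at `p` from one side of `A` to the other: in every sufficiently small
ball around `p`, the set `A` separates two points of `B`. -/
def PassesThrough (A B : Set Plane) (p : Plane) : Prop :=
  ∀ᶠ ε in 𝓝[>] (0 : ℝ), ∃ x ∈ (B ∩ Metric.ball p ε) \ A, ∃ y ∈ (B ∩ Metric.ball p ε) \ A,
    ¬ JoinedIn (Metric.ball p ε \ A) x y

/-- A 1-planar drawing of `G` in the plane. Vertices are distinct points, an edge is a polygonal
arc between its two endvertices that contains no other vertex, any point common to the interiors of
two edges is a proper crossing (edges do not just touch), adjacent edges do not cross, and every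
edge is crossed at most once. -/
structure OnePlanarDrawing {V : Type*} (G : SimpleGraph V) where
  vert : V → Plane
  vert_injective : Function.Injective vert
  arc : G.edgeSet → PolygonalArc
  arc_ends : ∀ e : G.edgeSet, s((arc e).source, (arc e).target) = Sym2.map vert (e : Sym2 V)
  vert_not_mem_inner : ∀ (e : G.edgeSet) (v : V), vert v ∉ (arc e).inner
  proper : ∀ e f : G.edgeSet, e ≠ f → ∀ p ∈ (arc e).inner ∩ (arc f).inner,
    PassesThrough (arc e).carrier (arc f).carrier p
  adjacent_not_cross : ∀ e f : G.edgeSet, e ≠ f → (∃ v, v ∈ (e : Sym2 V) ∧ v ∈ (f : Sym2 V)) →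
    Disjoint (arc e).inner (arc f).inner
  crossed_at_most_once : ∀ e f g : G.edgeSet, f ≠ e → g ≠ e →
    ∀ p ∈ (arc e).inner ∩ (arc f).inner, ∀ q ∈ (arc e).inner ∩ (arc g).inner, f = g ∧ p = q

namespace OnePlanarDrawing

variable {V : Type*} {G : SimpleGraph V}

/-- The crossings of the drawing (the false vertices of the associated plane graph). -/
def crossings (D : OnePlanarDrawing G) : Set Plane :=
  {p | ∃ e f : G.edgeSet, e ≠ f ∧ p ∈ (D.arc e).inner ∩ (D.arc f).inner}

/-- The associated plane graph `D^×`: its true vertices are `Sum.inl v`, its false vertices are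
`Sum.inr c`. Two true vertices are adjacent when they are joined by an edge that is not crossed; a
true vertex is adjacent to a false vertex `c` when it is an endvertex of an edge crossed at `c`
(no edge has a second crossing); false vertices are pairwise non-adjacent. -/
def associatedGraph (D : OnePlanarDrawing G) : SimpleGraph (V ⊕ D.crossings) where
  Adj
    | Sum.inl u, Sum.inl v => ∃ e : G.edgeSet, (e : Sym2 V) = s(u, v) ∧
        Disjoint (D.arc e).inner D.crossings
    | Sum.inl v, Sum.inr c => ∃ e : G.edgeSet, v ∈ (e : Sym2 V) ∧ (c : Plane) ∈ (D.arc e).inner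
    | Sum.inr c, Sum.inl v => ∃ e : G.edgeSet, v ∈ (e : Sym2 V) ∧ (c : Plane) ∈ (D.arc e).inner
    | Sum.inr _, Sum.inr _ => False
  symm := ⟨by
    rintro (u | c) (v | d) h
    · obtain ⟨e, he, hd⟩ := h
      exact ⟨e, he.trans Sym2.eq_swap, hd⟩
    · exact h
    · exact h
    · exact h⟩
  loopless := ⟨by
    rintro (u | c) h
    · obtain ⟨e, he, -⟩ := h
      exact G.loopless.irrefl u (by have := e.2; rwa [he] at this)
    · exact h⟩

/-- Any two false vertices have at most `i` common neighbours in the associated plane graph. -/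
def CommonNeighborsLE (D : OnePlanarDrawing G) (i : ℕ) : Prop :=
  ∀ c₁ c₂ : D.crossings, c₁ ≠ c₂ →
    (D.associatedGraph.neighborSet (Sum.inr c₁) ∩
      D.associatedGraph.neighborSet (Sum.inr c₂)).encard ≤ i

end OnePlanarDrawing

/-- The graph `G` is of class `𝒞₀`. -/
def IsClassC0 {V : Type*} (G : SimpleGraph V) : Prop :=
  ∃ D : OnePlanarDrawing G, D.CommonNeighborsLE 0

/-- The graph `G` is of class `𝒞₁`. -/
def IsClassC1 {V : Type*} (G : SimpleGraph V) : Prop :=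
  ¬ IsClassC0 G ∧ ∃ D : OnePlanarDrawing G, D.CommonNeighborsLE 1

/-- The join `G + H`: disjoint copies of `G` and `H` together with all edges between them. -/
def join {V W : Type*} (G : SimpleGraph V) (H : SimpleGraph W) : SimpleGraph (V ⊕ W) :=
  (G ⊕g H) ⊔ completeBipartiteGraph V W

end OnePlanar

/-! Let `N` be the order of the join and `c` the number of crossings of a 1-planar drawing of it.
Deleting one edge at each crossing leaves a plane simple graph, so the join has at most `3N - 6 + c`
edges (`card_edges_add_six_le`). To bound `c`, consider the plane bipartite graph that links each
crossing to the four ends of its two edges. If two crossings never share two neighbours, this graph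
has no 4-cycle, so every face boundary has at least six edges, and Euler's formula for `4c` edges
and `N + c` vertices gives `5c + 6 ≤ 3N` (`five_mul_card_add_six_le`). With `N = |V(G)| + 1` and the
`|V(G)|` spokes subtracted, this is (a). A graph outside `𝒞₀` has a crossing in every drawing, which
guarantees `N ≥ 4`.

In a drawing witnessing `𝒞₀` the crossings have disjoint quadruples of neighbours, so `4c ≤ N`, and
a graph with too many edges is not in `𝒞₀` (`not_isClassC0`). For (b), take a path on a parabola
with chords that cut the polygon into triangles and quadrilaterals having both diagonals, any two
quadrilaterals sharing at most one corner. A far point below the parabola sees every vertex, so the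
join is drawn with straight segments; its edge count excludes `𝒞₀` once `k ≥ 2`.

Only the inequality `E + 2 ≤ V + F` of Euler's formula is needed, and it is proved by linear
algebra. A flow with zero net flow at every vertex has a winding function, constant on faces, which
jumps by `2π` times the flow across an edge. Circulations and constants thus embed into the
functions on faces, while the net flows span dimension at most `V - 1`. Polygonal arcs reduce to
straight segments by treating bends as vertices. -/

namespace OnePlanar

/-! ### Coordinates along a segment -/

/-- The complex coordinate in which `a` is `0` and `b` is `1`. -/
noncomputable def segCoord (a b q : ℂ) : ℂ := (q - a) / (b - a)

lemma continuous_segCoord (a b : ℂ) : Continuous (segCoord a b) := by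
  unfold segCoord; fun_prop

lemma eq_add_segCoord_mul {a b : ℂ} (h : a ≠ b) (q : ℂ) : q = a + segCoord a b q * (b - a) := by
  have : b - a ≠ 0 := sub_ne_zero.2 h.symm
  unfold segCoord; field_simp; ring

lemma segCoord_add_mul {a b : ℂ} (h : a ≠ b) (z : ℂ) : segCoord a b (a + z * (b - a)) = z := by
  have : b - a ≠ 0 := sub_ne_zero.2 h.symm
  unfold segCoord; field_simp; ring

lemma segCoord_combo {a b : ℂ} (x y : ℂ) {s t : ℝ} (hst : s + t = 1) :
    segCoord a b (s • x + t • y) = s • segCoord a b x + t • segCoord a b y := by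
  have : (s : ℂ) + t = 1 := by exact_mod_cast hst
  simp only [segCoord, Complex.real_smul, ← mul_div_assoc, ← add_div]
  congr 1
  linear_combination a * this

lemma mem_openSegment_iff_segCoord {a b : ℂ} (h : a ≠ b) (q : ℂ) :
    q ∈ openSegment ℝ a b ↔
      (segCoord a b q).im = 0 ∧ 0 < (segCoord a b q).re ∧ (segCoord a b q).re < 1 := by
  rw [openSegment_eq_image]
  constructor
  · rintro ⟨t, ⟨h0, h1⟩, rfl⟩
    have : (fun θ : ℝ => (1 - θ) • a + θ • b) t = a + (t : ℂ) * (b - a) := by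
      simp only [Complex.real_smul]; push_cast; ring
    rw [this, segCoord_add_mul h]
    simp [h0, h1]
  · rintro ⟨hi, h0, h1⟩
    refine ⟨(segCoord a b q).re, ⟨h0, h1⟩, ?_⟩
    have e : ((segCoord a b q).re : ℂ) = segCoord a b q := by
      apply Complex.ext <;> simp [hi]
    simp only [Complex.real_smul]; push_cast; rw [e]
    conv_rhs => rw [eq_add_segCoord_mul h q]
    ring

/-- The open half plane on the side `σ` of the line through `a` and `b`. -/
def halfPlane (a b : ℂ) (σ : ℝ) : Set ℂ := {q | 0 < σ * (segCoord a b q).im}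

lemma convex_halfPlane (a b : ℂ) (σ : ℝ) : Convex ℝ (halfPlane a b σ) := by
  intro x hx y hy s t hs ht hst
  simp only [halfPlane, mem_ofPred_eq] at *
  rw [segCoord_combo x y hst]
  simp only [Complex.add_im, Complex.real_smul, Complex.im_ofReal_mul]
  rcases hs.eq_or_lt with rfl | hs
  · have : t = 1 := by linarith
    subst this; simpa using hy
  · nlinarith [mul_pos hs hx, mul_nonneg ht hy.le]

lemma mem_closure_halfPlane {a b p : ℂ} (h : a ≠ b) (hp : p ∈ openSegment ℝ a b) {σ : ℝ}
    (hσ : σ ≠ 0) : (𝓝[halfPlane a b σ] p).NeBot := by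
  rw [← mem_closure_iff_nhdsWithin_neBot]
  have hc : Continuous fun t : ℝ => p + (t * σ * Complex.I : ℂ) * (b - a) := by fun_prop
  have h0 : Tendsto (fun t : ℝ => p + (t * σ * Complex.I : ℂ) * (b - a)) (𝓝[>] 0) (𝓝 p) := by
    have := hc.tendsto 0
    simp only [Complex.ofReal_zero, zero_mul, add_zero] at this
    exact this.mono_left nhdsWithin_le_nhds
  refine mem_closure_of_tendsto h0 ?_
  filter_upwards [self_mem_nhdsWithin] with t ht
  have hz := ((mem_openSegment_iff_segCoord h p).1 hp).1
  have : segCoord a b (p + (t * σ * Complex.I : ℂ) * (b - a))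
      = segCoord a b p + (t * σ * Complex.I : ℂ) := by
    have : b - a ≠ 0 := sub_ne_zero.2 h.symm
    unfold segCoord; field_simp; ring
  simp only [halfPlane, mem_ofPred_eq, this, Complex.add_im, hz]
  simp only [← Complex.ofReal_mul, Complex.im_ofReal_mul, Complex.I_im, mul_one, zero_add]
  have : 0 < σ * σ := mul_self_pos.2 hσ
  have := mul_pos (show (0:ℝ) < t from ht) this
  nlinarith

lemma isClosed_segment (a b : ℂ) : IsClosed (segment ℝ a b) := by
  rw [← convexHull_pair]
  exact ((Set.toFinite {a, b}).isCompact_convexHull (𝕜 := ℝ)).isClosed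

/-! ### The angle under which a segment is seen -/

/-- The angle under which the segment from `a` to `b` is seen from `q`. -/
noncomputable def viewAngle (a b q : ℂ) : ℝ := ((b - q) / (a - q)).arg

/-- If the quotient were a real number `r ≤ 0`, then `b - q` would be a nonpositive multiple of `a -
q`, placing `q` between `a` and `b`. -/
lemma div_mem_slitPlane {a b q : ℂ} (hq : q ∉ segment ℝ a b) :
    (b - q) / (a - q) ∈ Complex.slitPlane := by
  have ha : a - q ≠ 0 := by
    intro h; apply hq; rw [← sub_eq_zero.1 h]; exact left_mem_segment ℝ a b
  rw [Complex.mem_slitPlane_iff]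
  by_contra hcon
  push Not at hcon
  obtain ⟨h1, h2⟩ := hcon
  set r := ((b - q) / (a - q)).re with hr
  have e : (b - q) / (a - q) = (r : ℂ) := by apply Complex.ext <;> simp [h2, hr]
  have e2 : b - q = r * (a - q) := by rw [← e]; field_simp
  apply hq
  have h3 : (0 : ℝ) < 1 - r := by linarith
  refine ⟨-r / (1 - r), 1 / (1 - r), div_nonneg (by linarith) h3.le, by positivity,
    by field_simp; ring, ?_⟩
  have h4 : (1 - r : ℂ) ≠ 0 := by exact_mod_cast h3.ne'
  simp only [Complex.real_smul]; push_cast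
  field_simp
  linear_combination e2

lemma continuousAt_viewAngle {a b q : ℂ} (hq : q ∉ segment ℝ a b) :
    ContinuousAt (viewAngle a b) q := by
  have ha : a - q ≠ 0 := by
    intro h; apply hq; rw [← sub_eq_zero.1 h]; exact left_mem_segment ℝ a b
  refine ContinuousAt.comp (g := Complex.arg) (f := fun q => (b - q) / (a - q))
    (Complex.continuousAt_arg (div_mem_slitPlane hq)) ?_
  exact ContinuousAt.div (by fun_prop) (by fun_prop) ha

/-- The two sides agree modulo `2π`, and their difference `t` is continuous at `q₀` and vanishes
there, so no multiple of `2π` can appear nearby. The increment is a term for `b` minus the same term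
for `a`, the form that cancels when summed against a circulation. -/
lemma viewAngle_eventuallyEq {a b q₀ : ℂ} (hq : q₀ ∉ segment ℝ a b) :
    ∀ᶠ q in 𝓝 q₀, viewAngle a b q = viewAngle a b q₀ +
      (((b - q) / (b - q₀)).arg - ((a - q) / (a - q₀)).arg) := by
  have ha : a - q₀ ≠ 0 := by
    intro h; apply hq; rw [← sub_eq_zero.1 h]; exact left_mem_segment ℝ a b
  have hb : b - q₀ ≠ 0 := by
    intro h; apply hq; rw [← sub_eq_zero.1 h]; exact right_mem_segment ℝ a b
  let t : ℂ → ℝ := fun q => viewAngle a b q - viewAngle a b q₀ -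
      (((b - q) / (b - q₀)).arg - ((a - q) / (a - q₀)).arg)
  have hcont : ∀ c : ℂ, c - q₀ ≠ 0 → ContinuousAt (fun q => ((c - q) / (c - q₀)).arg) q₀ := by
    intro c hc
    refine ContinuousAt.comp (g := Complex.arg) (f := fun q => (c - q) / (c - q₀)) ?_
      (by fun_prop)
    apply Complex.continuousAt_arg
    rw [div_self hc]; simp
  have ht : ContinuousAt t q₀ :=
    ((continuousAt_viewAngle hq).sub continuousAt_const).sub ((hcont b hb).sub (hcont a ha))
  have ht0 : t q₀ = 0 := by simp [t, div_self ha, div_self hb]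
  have h1 : ∀ᶠ q in 𝓝 q₀, |t q| < 2 * Real.pi := by
    have : Tendsto (fun q => |t q|) (𝓝 q₀) (𝓝 0) := by
      have := ht.abs.tendsto; simpa [ht0] using this
    exact this.eventually_lt_const (by positivity)
  have h2 : ∀ᶠ q in 𝓝 q₀, a - q ≠ 0 :=
    (continuousAt_const.sub continuousAt_id).eventually_ne ha
  have h3 : ∀ᶠ q in 𝓝 q₀, b - q ≠ 0 :=
    (continuousAt_const.sub continuousAt_id).eventually_ne hb
  filter_upwards [h1, h2, h3] with q h1 h2 h3
  have key : ((t q : ℝ) : Real.Angle) = ((0 : ℝ) : Real.Angle) := by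
    simp only [t, viewAngle, Real.Angle.coe_sub]
    rw [Complex.arg_div_coe_angle h3 h2, Complex.arg_div_coe_angle hb ha,
      Complex.arg_div_coe_angle h3 hb, Complex.arg_div_coe_angle h2 ha, Real.Angle.coe_zero]
    abel
  obtain ⟨k, hk⟩ := Real.Angle.angle_eq_iff_two_pi_dvd_sub.1 key
  rw [sub_zero] at hk
  have hk0 : k = 0 := by
    rw [hk, abs_mul, abs_of_pos Real.two_pi_pos] at h1
    have : |(k : ℝ)| < 1 := by
      have := Real.two_pi_pos
      nlinarith [abs_nonneg (k : ℝ)]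
    have : |k| < 1 := by exact_mod_cast this
    exact Int.abs_lt_one_iff.1 this
  rw [hk0] at hk
  simp only [t] at hk
  push_cast at hk
  linarith

/-- In terms of the coordinate `s = segCoord a b q` the quotient is `1 - 1/s`. At `p` it is a
negative real, and its imaginary part has the sign of `s.im`, so crossing the segment means crossing
the branch cut of `arg`. -/
lemma tendsto_viewAngle {a b p : ℂ} (h : a ≠ b) (hp : p ∈ openSegment ℝ a b) :
    Tendsto (viewAngle a b) (𝓝[halfPlane a b 1] p) (𝓝 Real.pi) ∧
    Tendsto (viewAngle a b) (𝓝[halfPlane a b (-1)] p) (𝓝 (-Real.pi)) := by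
  obtain ⟨hi, h0, h1⟩ := (mem_openSegment_iff_segCoord h p).1 hp
  have hba : b - a ≠ 0 := sub_ne_zero.2 h.symm
  have hpa : a - p ≠ 0 := by
    intro hc
    have : segCoord a b p = 0 := by
      unfold segCoord; rw [← neg_sub a p, hc]; simp
    rw [this] at h0; simp at h0
  have hform : ∀ q, a - q ≠ 0 → (b - q) / (a - q) = 1 - (segCoord a b q)⁻¹ := by
    intro q hq
    have hq' : q - a ≠ 0 := by rw [← neg_sub]; exact neg_ne_zero.2 hq
    unfold segCoord; field_simp; ring
  have hc : ContinuousAt (fun q => (b - q) / (a - q)) p :=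
    ContinuousAt.div (by fun_prop) (by fun_prop) hpa
  have hval : (b - p) / (a - p) = ((1 - (segCoord a b p).re⁻¹ : ℝ) : ℂ) := by
    have e : segCoord a b p = ((segCoord a b p).re : ℂ) := by apply Complex.ext <;> simp [hi]
    rw [hform p hpa, e]; push_cast; simp
  have hre : ((b - p) / (a - p)).re < 0 := by
    rw [hval, Complex.ofReal_re]
    have := one_lt_inv₀ h0 |>.2 h1
    linarith
  have him : ((b - p) / (a - p)).im = 0 := by rw [hval, Complex.ofReal_im]
  have himq : ∀ q, a - q ≠ 0 → segCoord a b q ≠ 0 → ((b - q) / (a - q)).im =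
      (segCoord a b q).im / Complex.normSq (segCoord a b q) := by
    intro q hq _
    rw [hform q hq]; simp [Complex.inv_im, neg_div]
  constructor
  · have := Complex.continuousWithinAt_arg_of_re_neg_of_im_zero hre him
    have harg : ((b - p) / (a - p)).arg = Real.pi := Complex.arg_eq_pi_iff.2 ⟨hre, him⟩
    unfold ContinuousWithinAt at this
    rw [harg] at this
    refine this.comp (tendsto_nhdsWithin_iff.2 ⟨hc.tendsto.mono_left nhdsWithin_le_nhds, ?_⟩)
    filter_upwards [self_mem_nhdsWithin] with q hq
    simp only [halfPlane, mem_ofPred_eq, one_mul] at hq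
    have hs : segCoord a b q ≠ 0 := by intro hs; rw [hs] at hq; simp at hq
    have hqa : a - q ≠ 0 := by
      intro hc; apply hs; unfold segCoord; rw [← neg_sub a q, hc]; simp
    change 0 ≤ ((b - q) / (a - q)).im
    rw [himq q hqa hs]
    exact div_nonneg hq.le (Complex.normSq_nonneg _)
  · have := Complex.tendsto_arg_nhdsWithin_im_neg_of_re_neg_of_im_zero hre him
    refine this.comp (tendsto_nhdsWithin_iff.2 ⟨hc.tendsto.mono_left nhdsWithin_le_nhds, ?_⟩)
    filter_upwards [self_mem_nhdsWithin] with q hq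
    simp only [halfPlane, mem_ofPred_eq] at hq
    have hs : segCoord a b q ≠ 0 := by intro hs; rw [hs] at hq; simp at hq
    have hqa : a - q ≠ 0 := by
      intro hc; apply hs; unfold segCoord; rw [← neg_sub a q, hc]; simp
    change ((b - q) / (a - q)).im < 0
    rw [himq q hqa hs]
    exact div_neg_of_neg_of_pos (by linarith) (Complex.normSq_pos.2 hs)

/-- A disc without one of its radii is connected. -/
lemma isPreconnected_ball_diff_segment {a b : ℂ} (h : a ≠ b) {r : ℝ} (hr : 0 < r)
    (hrb : r ≤ dist a b) : IsPreconnected (Metric.ball a r \ segment ℝ a b) := by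
  have hba : b - a ≠ 0 := sub_ne_zero.2 h.symm
  have hn : 0 < ‖b - a‖ := norm_pos_iff.2 hba
  have hdist : dist a b = ‖b - a‖ := by rw [dist_comm, dist_eq_norm]
  -- In the coordinate where `a` is `0` and `b` is `1`, the removed radius becomes the ray of
  -- nonnegative reals, since `r ≤ dist a b` keeps the ball short of `b`.
  have hset : Metric.ball a r \ segment ℝ a b =
      {q | q ∈ Metric.ball a r ∧ -segCoord a b q ∈ Complex.slitPlane} := by
    ext q
    simp only [Set.mem_sdiff, mem_ofPred_eq, and_congr_right_iff]
    intro hq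
    rw [← not_iff_not, not_not, Complex.mem_slitPlane_iff]
    push Not
    rw [← insert_endpoints_openSegment]
    simp only [mem_insert_iff, mem_openSegment_iff_segCoord h, Complex.neg_re, Complex.neg_im,
      neg_eq_zero, Left.neg_nonpos_iff]
    have hq2 : ‖segCoord a b q‖ < 1 := by
      unfold segCoord
      rw [norm_div, div_lt_one hn, ← hdist, ← dist_eq_norm]
      exact lt_of_lt_of_le hq hrb
    have hre1 : (segCoord a b q).re < 1 := lt_of_le_of_lt (Complex.re_le_norm _) hq2
    constructor
    · rintro (rfl | rfl | ⟨h1, h2, h3⟩)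
      · simp [segCoord]
      · simp [segCoord, div_self hba]
      · exact ⟨h2.le, h1⟩
    · rintro ⟨h1, h2⟩
      rcases h1.eq_or_lt with h1 | h1
      · left
        have : segCoord a b q = 0 := Complex.ext h1.symm h2
        rw [eq_add_segCoord_mul h q, this]; simp
      · right; right; exact ⟨h2, h1, hre1⟩
  rw [hset]
  -- The star centre lies at distance `r / 2` from `a`, on the side of `a` opposite to `b`.
  set τ : ℝ := r / (2 * ‖b - a‖) with hτ
  have hτ0 : 0 < τ := by positivity
  have hc : segCoord a b (a + (-τ : ℂ) * (b - a)) = -τ := segCoord_add_mul h _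
  have hmem : a + (-τ : ℂ) * (b - a) ∈ {q | q ∈ Metric.ball a r ∧
      -segCoord a b q ∈ Complex.slitPlane} := by
    refine ⟨?_, ?_⟩
    · rw [Metric.mem_ball, dist_eq_norm, add_sub_cancel_left, norm_mul, norm_neg,
        Complex.norm_real, Real.norm_of_nonneg hτ0.le, hτ]
      field_simp; linarith
    · rw [hc]; simp [hτ0]
  refine (StarConvex.isPathConnected (a := a + (-τ : ℂ) * (b - a)) ?_ hmem).isConnected.isPreconnected
  intro q hq s t hs ht hst
  refine ⟨convex_ball a r hmem.1 hq.1 hs ht hst, ?_⟩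
  rw [segCoord_combo _ _ hst, hc]
  have := Complex.starConvex_ofReal_slitPlane hτ0 hq.2 hs ht hst
  convert this using 1
  simp only [Complex.real_smul]; ring

/-! ### Straight-line plane graphs, their faces and the sides of their edges. -/

/-- A (multi)graph drawn in the complex plane with straight edges that do not cross. -/
structure StraightPlaneGraph (V E : Type*) where
  pos : V → ℂ
  src : E → V
  tgt : E → V
  pos_injective : Function.Injective pos
  src_ne_tgt : ∀ e, src e ≠ tgt e
  pos_notMem : ∀ e v, pos v ∉ openSegment ℝ (pos (src e)) (pos (tgt e))
  disjoint : ∀ e e', e ≠ e' → Disjoint (openSegment ℝ (pos (src e)) (pos (tgt e)))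
    (openSegment ℝ (pos (src e')) (pos (tgt e')))

namespace StraightPlaneGraph

variable {V E : Type*} (H : StraightPlaneGraph V E)

/-- The interior of an edge. -/
def openEdge (e : E) : Set ℂ := openSegment ℝ (H.pos (H.src e)) (H.pos (H.tgt e))

/-- An edge with its ends. -/
def closedEdge (e : E) : Set ℂ := segment ℝ (H.pos (H.src e)) (H.pos (H.tgt e))

/-- The vertex `v` is an end of the edge `e`. -/
def Inc (e : E) (v : V) : Prop := H.src e = v ∨ H.tgt e = v

/-- The complement of the drawing. -/
def region : Set ℂ := (⋃ e, H.closedEdge e)ᶜ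

/-- The half plane on the side `σ` of an edge. -/
def half (e : E) (σ : ℝ) : Set ℂ := halfPlane (H.pos (H.src e)) (H.pos (H.tgt e)) σ

lemma pos_src_ne (e : E) : H.pos (H.src e) ≠ H.pos (H.tgt e) :=
  fun h => H.src_ne_tgt e (H.pos_injective h)

lemma openEdge_subset (e : E) : H.openEdge e ⊆ H.closedEdge e := openSegment_subset_segment _ _ _

lemma mem_closedEdge_iff {e : E} {q : ℂ} :
    q ∈ H.closedEdge e ↔ (∃ v, H.Inc e v ∧ q = H.pos v) ∨ q ∈ H.openEdge e := by
  unfold closedEdge openEdge Inc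
  rw [← insert_endpoints_openSegment]
  simp only [mem_insert_iff]
  constructor
  · rintro (h | h | h)
    · exact Or.inl ⟨_, Or.inl rfl, h⟩
    · exact Or.inl ⟨_, Or.inr rfl, h⟩
    · exact Or.inr h
  · rintro (⟨v, rfl | rfl, h⟩ | h)
    · exact Or.inl h
    · exact Or.inr (Or.inl h)
    · exact Or.inr (Or.inr h)

lemma pos_mem_closedEdge {e : E} {v : V} (h : H.Inc e v) : H.pos v ∈ H.closedEdge e :=
  H.mem_closedEdge_iff.2 (Or.inl ⟨v, h, rfl⟩)

lemma openEdge_disjoint_closedEdge {e e' : E} (h : e ≠ e') :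
    Disjoint (H.openEdge e) (H.closedEdge e') := by
  rw [Set.disjoint_left]
  intro q hq hq'
  rcases H.mem_closedEdge_iff.1 hq' with ⟨v, -, rfl⟩ | hq'
  · exact H.pos_notMem e v hq
  · exact Set.disjoint_left.1 (H.disjoint e e' h) hq hq'

lemma mem_region {q : ℂ} : q ∈ H.region ↔ ∀ e, q ∉ H.closedEdge e := by
  simp [region]

lemma openEdge_nonempty (e : E) : (H.openEdge e).Nonempty :=
  ⟨_, midpoint_mem_openSegment _ _⟩

/-- The sign of a side. -/
def sgn (b : Bool) : ℝ := if b then 1 else -1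

lemma sgn_ne_zero (b : Bool) : sgn b ≠ 0 := by cases b <;> simp [sgn]

lemma neBot_half (e : E) (b : Bool) {p : ℂ} (hp : p ∈ H.openEdge e) :
    (𝓝[H.half e (sgn b)] p).NeBot :=
  mem_closure_halfPlane (H.pos_src_ne e) hp (sgn_ne_zero b)

variable [Finite E]

lemma isOpen_region : IsOpen H.region :=
  (isClosed_iUnion_of_finite fun _ => isClosed_segment _ _).isOpen_compl

/-- Along the interior of an edge, each side of the edge lies in one piece of the complement. -/
lemma exists_preconnected_side (e : E) (σ : ℝ) {p₀ p : ℂ} (hp₀ : p₀ ∈ H.openEdge e)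
    (hp : p ∈ H.openEdge e) :
    ∃ S : Set ℂ, S ∈ 𝓝[H.half e σ] p₀ ∧ S ∈ 𝓝[H.half e σ] p ∧ IsPreconnected S ∧ S ⊆ H.region := by
  have hK : IsClosed (⋃ e' : {e' // e' ≠ e}, H.closedEdge e') :=
    isClosed_iUnion_of_finite fun _ => isClosed_segment _ _
  have hsub : segment ℝ p₀ p ⊆ (⋃ e' : {e' // e' ≠ e}, H.closedEdge e')ᶜ := by
    intro q hq hq'
    obtain ⟨e', he'⟩ := mem_iUnion.1 hq'
    exact Set.disjoint_left.1 (H.openEdge_disjoint_closedEdge e'.2.symm)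
      ((convex_openSegment _ _).segment_subset hp₀ hp hq) he'
  have hcomp : IsCompact (segment ℝ p₀ p) := by
    rw [← convexHull_pair]
    exact (Set.toFinite {p₀, p}).isCompact_convexHull (𝕜 := ℝ)
  -- A thin neighbourhood of the part of the edge between the two points avoids all other edges; cut
  -- down to one side it is convex and avoids this edge as well.
  obtain ⟨δ, hδ, hthick⟩ := hcomp.exists_thickening_subset_open hK.isOpen_compl hsub
  refine ⟨Metric.thickening δ (segment ℝ p₀ p) ∩ H.half e σ, ?_, ?_, ?_, ?_⟩
  · exact inter_mem (mem_nhdsWithin_of_mem_nhds (Metric.isOpen_thickening.mem_nhds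
      (Metric.self_subset_thickening hδ _ (left_mem_segment ℝ _ _)))) self_mem_nhdsWithin
  · exact inter_mem (mem_nhdsWithin_of_mem_nhds (Metric.isOpen_thickening.mem_nhds
      (Metric.self_subset_thickening hδ _ (right_mem_segment ℝ _ _)))) self_mem_nhdsWithin
  · exact (((convex_segment _ _).thickening δ).inter (convex_halfPlane _ _ σ)).isPreconnected
  · rintro q ⟨hq1, hq2⟩
    rw [mem_region]
    intro e' he'
    by_cases hee : e' = e
    · subst hee
      have hz : (segCoord (H.pos (H.src e')) (H.pos (H.tgt e')) q).im = 0 := by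
        rcases H.mem_closedEdge_iff.1 he' with ⟨v, rfl | rfl, rfl⟩ | h
        · simp [segCoord]
        · rw [segCoord, div_self (sub_ne_zero.2 (H.pos_src_ne e').symm)]; simp
        · exact ((mem_openSegment_iff_segCoord (H.pos_src_ne e') q).1 h).1
      have : 0 < σ * (segCoord (H.pos (H.src e')) (H.pos (H.tgt e')) q).im := hq2
      rw [hz] at this
      simp at this
    · exact hthick hq1 (mem_iUnion.2 ⟨⟨e', hee⟩, he'⟩)

/-- The component found close to one base point `p₀` serves for every `p`: a connected one-sided set
reaches from `p₀` to `p`. -/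
lemma exists_side (e : E) {σ : ℝ} (hσ : σ ≠ 0) : ∃ f : Set ℂ, ∀ p ∈ H.openEdge e,
    ∀ᶠ q in 𝓝[H.half e σ] p, q ∈ H.region ∧ connectedComponentIn H.region q = f := by
  obtain ⟨p₀, hp₀⟩ := H.openEdge_nonempty e
  obtain ⟨S₀, hS₀, -, hS₀c, hS₀r⟩ := H.exists_preconnected_side e σ hp₀ hp₀
  have hne : (𝓝[H.half e σ] p₀).NeBot := mem_closure_halfPlane (H.pos_src_ne e) hp₀ hσ
  obtain ⟨q₀, hq₀⟩ := hne.nonempty_of_mem hS₀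
  refine ⟨connectedComponentIn H.region q₀, fun p hp => ?_⟩
  obtain ⟨S, hS1, hS2, hSc, hSr⟩ := H.exists_preconnected_side e σ hp₀ hp
  obtain ⟨q₁, hq₁⟩ := hne.nonempty_of_mem (inter_mem hS₀ hS1)
  filter_upwards [hS2] with q hq
  refine ⟨hSr hq, ?_⟩
  exact (connectedComponentIn_eq (hSc.subset_connectedComponentIn hq hSr hq₁.2)).trans
    (connectedComponentIn_eq (hS₀c.subset_connectedComponentIn hq₀ hS₀r hq₁.1)).symm

/-- The face on a side of an edge. -/
noncomputable def side (e : E) (b : Bool) : Set ℂ := (H.exists_side e (sgn_ne_zero b)).choose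

lemma side_spec (e : E) (b : Bool) {p : ℂ} (hp : p ∈ H.openEdge e) :
    ∀ᶠ q in 𝓝[H.half e (sgn b)] p,
      q ∈ H.region ∧ connectedComponentIn H.region q = H.side e b :=
  (H.exists_side e (sgn_ne_zero b)).choose_spec p hp

/-! ### Faces that are the same on both sides of an edge -/

/-- `e` separates the face `f` from another face. -/
def Bounds (e : E) (f : Set ℂ) : Prop := ¬ (H.side e true = f ↔ H.side e false = f)

/-- `q` lies in the face `f` or in an edge with the face `f` on its sides. -/
def InFace (f : Set ℂ) (q : ℂ) : Prop :=
  q ∈ H.region ∧ connectedComponentIn H.region q = f ∨ ∃ e, q ∈ H.openEdge e ∧ H.side e true = f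

/-- The points of the complement and of the edges that do not bound `f`. -/
def regular (f : Set ℂ) : Set ℂ :=
  {q | q ∈ H.region ∨ ∃ e, q ∈ H.openEdge e ∧ ¬ H.Bounds e f}

lemma inFace_of_mem_region {f : Set ℂ} {q : ℂ} (hq : q ∈ H.region) :
    H.InFace f q ↔ connectedComponentIn H.region q = f := by
  constructor
  · rintro (h | ⟨e, he, -⟩)
    · exact h.2
    · exact absurd (H.openEdge_subset e he) (H.mem_region.1 hq e)
  · exact fun h => Or.inl ⟨hq, h⟩

lemma inFace_of_mem_openEdge {f : Set ℂ} {q : ℂ} {e : E} (hq : q ∈ H.openEdge e) :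
    H.InFace f q ↔ H.side e true = f := by
  constructor
  · rintro (h | ⟨e', he', h⟩)
    · exact absurd (H.openEdge_subset e hq) (H.mem_region.1 h.1 e)
    · by_cases hee : e' = e
      · exact hee ▸ h
      · exact absurd hq (Set.disjoint_left.1 (H.disjoint e' e hee) he')
  · exact fun h => Or.inr ⟨e, hq, h⟩

lemma eventually_mem_region {q : ℂ} (hq : q ∈ H.region) :
    ∀ᶠ q' in 𝓝 q, q' ∈ H.region ∧
      connectedComponentIn H.region q' = connectedComponentIn H.region q := by
  filter_upwards [H.isOpen_region.connectedComponentIn.mem_nhds (mem_connectedComponentIn hq)]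
    with q' hq'
  exact ⟨connectedComponentIn_subset _ _ hq', (connectedComponentIn_eq hq').symm⟩

/-- An edge that does not bound `f` has `f` on both sides or on neither, so crossing it does not
change membership. Hence `InFace f` is locally constant on `regular f` and constant on its connected
subsets. -/
lemma eventually_inFace {f : Set ℂ} {q : ℂ} (hq : q ∈ H.regular f) :
    ∀ᶠ q' in 𝓝 q, (H.InFace f q ↔ H.InFace f q') := by
  rcases hq with hq | ⟨e, hqe, he⟩
  · filter_upwards [H.eventually_mem_region hq] with q' ⟨hq', hc⟩
    rw [H.inFace_of_mem_region hq, H.inFace_of_mem_region hq', hc]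
  · have h1 := eventually_nhdsWithin_iff.1 (H.side_spec e true hqe)
    have h2 := eventually_nhdsWithin_iff.1 (H.side_spec e false hqe)
    have hcr := (mem_openSegment_iff_segCoord (H.pos_src_ne e) q).1 hqe
    have hcont := continuous_segCoord (H.pos (H.src e)) (H.pos (H.tgt e))
    have h3 : ∀ᶠ q' in 𝓝 q, 0 < (segCoord (H.pos (H.src e)) (H.pos (H.tgt e)) q').re :=
      (Complex.continuous_re.comp hcont).continuousAt.eventually (lt_mem_nhds hcr.2.1)
    have h4 : ∀ᶠ q' in 𝓝 q, (segCoord (H.pos (H.src e)) (H.pos (H.tgt e)) q').re < 1 :=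
      (Complex.continuous_re.comp hcont).continuousAt.eventually (gt_mem_nhds hcr.2.2)
    filter_upwards [h1, h2, h3, h4] with q' h1 h2 h3 h4
    rw [H.inFace_of_mem_openEdge hqe]
    have he' : H.side e true = f ↔ H.side e false = f := not_not.1 he
    rcases lt_trichotomy (segCoord (H.pos (H.src e)) (H.pos (H.tgt e)) q').im 0 with h | h | h
    · have := h2 (by simp only [half, halfPlane, sgn, mem_ofPred_eq]; simpa using h)
      rw [H.inFace_of_mem_region this.1, this.2, he']
    · rw [H.inFace_of_mem_openEdge
        ((mem_openSegment_iff_segCoord (H.pos_src_ne e) q').2 ⟨h, h3, h4⟩)]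
    · have := h1 (by simp only [half, halfPlane, sgn, mem_ofPred_eq]; simpa using h)
      rw [H.inFace_of_mem_region this.1, this.2]

lemma inFace_congr {f : Set ℂ} {S : Set ℂ} (hS : IsPreconnected S) (hSf : S ⊆ H.regular f)
    {x y : ℂ} (hx : x ∈ S) (hy : y ∈ S) : H.InFace f x ↔ H.InFace f y :=
  hS.induction₂ (fun x y => H.InFace f x ↔ H.InFace f y)
    (fun _ hx => (H.eventually_inFace (hSf hx)).filter_mono nhdsWithin_le_nhds)
    (fun _ _ _ _ _ _ h h' => h.trans h') (fun _ _ _ _ h => h.symm) hx hy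

variable [Finite V]

/-- The edges bounding a face do not have a vertex of degree one. -/
lemma exists_bounds_ne {f : Set ℂ} {e : E} (he : H.Bounds e f) {v : V} (hv : H.Inc e v) :
    ∃ e', e' ≠ e ∧ H.Bounds e' f ∧ H.Inc e' v := by
  by_contra hcon
  push Not at hcon
  obtain ⟨u, huv, hseg⟩ : ∃ u, u ≠ v ∧ H.closedEdge e = segment ℝ (H.pos v) (H.pos u) := by
    rcases hv with rfl | rfl
    · exact ⟨H.tgt e, (H.src_ne_tgt e).symm, rfl⟩
    · exact ⟨H.src e, H.src_ne_tgt e, segment_symm _ _ _⟩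
  have hnear : ∀ᶠ q in 𝓝 (H.pos v), (∀ e', ¬ H.Inc e' v → q ∉ H.closedEdge e') ∧
      (∀ w, w ≠ v → q ≠ H.pos w) := by
    rw [eventually_and, eventually_all, eventually_all]
    refine ⟨fun e' => ?_, fun w => ?_⟩
    · rw [eventually_imp_distrib_left]
      intro h
      refine (isClosed_segment _ _).isOpen_compl.mem_nhds fun hmem => ?_
      rcases H.mem_closedEdge_iff.1 hmem with ⟨w, hw, hww⟩ | hmem
      · exact h (H.pos_injective hww ▸ hw)
      · exact H.pos_notMem e' v hmem
    · rw [eventually_imp_distrib_left]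
      intro h
      exact isOpen_ne.mem_nhds fun h' => h (H.pos_injective h').symm
  obtain ⟨r', hr', hball⟩ := Metric.eventually_nhds_iff_ball.1 hnear
  have hd : 0 < dist (H.pos v) (H.pos u) := dist_pos.2 fun h => huv (H.pos_injective h).symm
  set r := min r' (dist (H.pos v) (H.pos u)) with hr
  have hr0 : 0 < r := lt_min hr' hd
  have hpre := isPreconnected_ball_diff_segment (fun h => huv (H.pos_injective h).symm) hr0
    (min_le_right _ _)
  rw [← hseg] at hpre
  -- Near `v` only edges at `v` occur, and by assumption none of them except `e` bounds `f`. The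
  -- disc slit along `e` is connected, so both sides of `e` must agree about `f`, contrary to `he`.
  have hreg : Metric.ball (H.pos v) r \ H.closedEdge e ⊆ H.regular f := by
    rintro q ⟨hq, hqe⟩
    obtain ⟨h1, h2⟩ := hball q (Metric.ball_subset_ball (min_le_left _ _) hq)
    by_cases hqr : q ∈ H.region
    · exact Or.inl hqr
    · rw [mem_region] at hqr
      push Not at hqr
      obtain ⟨e', he'⟩ := hqr
      have hinc : H.Inc e' v := by
        by_contra h; exact h1 e' h he'
      have hne : e' ≠ e := fun h => hqe (h ▸ he')
      refine Or.inr ⟨e', ?_, fun hb => hcon e' hne hb hinc⟩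
      rcases H.mem_closedEdge_iff.1 he' with ⟨w, hw, rfl⟩ | h
      · by_cases hwv : w = v
        · exact absurd (H.pos_mem_closedEdge (hwv ▸ hv)) hqe
        · exact absurd rfl (h2 w hwv)
      · exact h
  obtain ⟨p, hpe, hpb⟩ : ∃ p ∈ H.openEdge e, p ∈ Metric.ball (H.pos v) r := by
    have : H.pos v ∈ closure (H.openEdge e) := by
      rw [openEdge, closure_openSegment]; exact H.pos_mem_closedEdge hv
    obtain ⟨p, hp⟩ := mem_closure_iff_nhds.1 this _ (Metric.ball_mem_nhds _ hr0)
    exact ⟨p, hp.2, hp.1⟩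
  have hside : ∀ b, ∃ q ∈ Metric.ball (H.pos v) r \ H.closedEdge e,
      (H.InFace f q ↔ H.side e b = f) := by
    intro b
    have := H.neBot_half e b hpe
    obtain ⟨q, ⟨hq1, hq2⟩, hq3⟩ := ((H.side_spec e b hpe).and
      (mem_nhdsWithin_of_mem_nhds (Metric.isOpen_ball.mem_nhds hpb))).exists
    exact ⟨q, ⟨hq3, H.mem_region.1 hq1 e⟩, by rw [H.inFace_of_mem_region hq1, hq2]⟩
  obtain ⟨q₁, hq₁, h₁⟩ := hside true
  obtain ⟨q₂, hq₂, h₂⟩ := hside false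
  exact he (h₁.symm.trans ((H.inFace_congr hpre hreg hq₁ hq₂).trans h₂))

/-- A face that no edge separates from another face is the only one. -/
lemma side_eq_of_forall_not_bounds {e₀ : E} {b₀ : Bool}
    (h : ∀ e, ¬ H.Bounds e (H.side e₀ b₀)) (e : E) (b : Bool) : H.side e b = H.side e₀ b₀ := by
  -- Removing finitely many points does not disconnect the plane; away from the vertices every point
  -- is regular for this face.
  have hpre : IsPreconnected (range H.pos)ᶜ :=
    ((Set.finite_range H.pos).countable.isConnected_compl_of_one_lt_rank
      (by rw [Complex.rank_real_complex]; exact Cardinal.one_lt_two)).isPreconnected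
  have hreg : (range H.pos)ᶜ ⊆ H.regular (H.side e₀ b₀) := by
    intro q hq
    by_cases hqr : q ∈ H.region
    · exact Or.inl hqr
    · rw [mem_region] at hqr
      push Not at hqr
      obtain ⟨e', he'⟩ := hqr
      rcases H.mem_closedEdge_iff.1 he' with ⟨w, -, rfl⟩ | h'
      · exact absurd (mem_range_self w) hq
      · exact Or.inr ⟨e', h', h e'⟩
  have hpt : ∀ e b, ∃ q ∈ (range H.pos)ᶜ, ∀ f, H.InFace f q ↔ H.side e b = f := by
    intro e b
    obtain ⟨p, hp⟩ := H.openEdge_nonempty e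
    have := H.neBot_half e b hp
    have hev : ∀ᶠ q in 𝓝[H.half e (sgn b)] p, q ∈ (range H.pos)ᶜ := by
      refine mem_nhdsWithin_of_mem_nhds
        ((Set.finite_range H.pos).isClosed.isOpen_compl.mem_nhds ?_)
      rintro ⟨w, rfl⟩
      exact H.pos_notMem e w hp
    obtain ⟨q, ⟨hq1, hq2⟩, hq3⟩ := ((H.side_spec e b hp).and hev).exists
    exact ⟨q, hq3, fun f => by rw [H.inFace_of_mem_region hq1, hq2]⟩
  obtain ⟨q₀, hq₀, h₀⟩ := hpt e₀ b₀
  obtain ⟨q, hq, h'⟩ := hpt e b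
  exact (h' _).1 ((H.inFace_congr hpre hreg hq₀ hq).1 ((h₀ _).2 rfl))

end StraightPlaneGraph
namespace StraightPlaneGraph

variable {V E : Type*} (H : StraightPlaneGraph V E) [Fintype E]

/-! ### Flows and the number of faces -/

open Classical in
/-- The faces adjacent to some edge. -/
noncomputable def faces : Finset (Set ℂ) :=
  Finset.univ.image fun x : E × Bool => H.side x.1 x.2

lemma side_mem_faces (e : E) (b : Bool) : H.side e b ∈ H.faces := by
  classical
  exact Finset.mem_image.2 ⟨(e, b), Finset.mem_univ _, rfl⟩

variable [Fintype V]

open Classical in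
/-- The net flow into each vertex. -/
noncomputable def netFlow : (E → ℝ) →ₗ[ℝ] (V → ℝ) where
  toFun z v := ∑ e, z e * ((if H.tgt e = v then 1 else 0) - (if H.src e = v then 1 else 0))
  map_add' z z' := by
    ext v; simp only [Pi.add_apply, add_mul, Finset.sum_add_distrib]
  map_smul' c z := by
    ext v; simp only [Pi.smul_apply, smul_eq_mul, RingHom.id_apply, Finset.mul_sum, mul_assoc]

/-- Summation by parts. When the net flow vanishes, differences of a vertex function along the edges
sum to zero. -/
lemma sum_netFlow_mul (z : E → ℝ) (g : V → ℝ) :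
    ∑ v, H.netFlow z v * g v = ∑ e, z e * (g (H.tgt e) - g (H.src e)) := by
  classical
  simp only [netFlow, LinearMap.coe_mk, AddHom.coe_mk, Finset.sum_mul]
  rw [Finset.sum_comm]
  refine Finset.sum_congr rfl fun e _ => ?_
  simp only [mul_assoc, ← Finset.mul_sum, sub_mul, ite_mul, one_mul, zero_mul,
    Finset.sum_sub_distrib, Finset.sum_ite_eq, Finset.mem_univ, if_true]

/-- The total winding of a flow around a point. -/
noncomputable def winding (z : E → ℝ) (q : ℂ) : ℝ :=
  ∑ e, z e * viewAngle (H.pos (H.src e)) (H.pos (H.tgt e)) q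

/-- By `viewAngle_eventuallyEq` the change of each summand is a difference of a vertex function
between the ends of the edge, so a circulation cancels it. -/
lemma winding_eventuallyEq {z : E → ℝ} (hz : H.netFlow z = 0) {q₀ : ℂ} (hq₀ : q₀ ∈ H.region) :
    ∀ᶠ q in 𝓝 q₀, H.winding z q₀ = H.winding z q := by
  have h : ∀ e, ∀ᶠ q in 𝓝 q₀, viewAngle (H.pos (H.src e)) (H.pos (H.tgt e)) q =
      viewAngle (H.pos (H.src e)) (H.pos (H.tgt e)) q₀ +
      (((H.pos (H.tgt e) - q) / (H.pos (H.tgt e) - q₀)).arg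
        - ((H.pos (H.src e) - q) / (H.pos (H.src e) - q₀)).arg) :=
    fun e => viewAngle_eventuallyEq (H.mem_region.1 hq₀ e)
  filter_upwards [eventually_all.2 h] with q hq
  have h0 := H.sum_netFlow_mul z fun v => ((H.pos v - q) / (H.pos v - q₀)).arg
  simp only [hz, Pi.zero_apply, zero_mul, Finset.sum_const_zero] at h0
  unfold winding
  simp only [hq, mul_add, Finset.sum_add_distrib, ← h0, add_zero]

lemma winding_eq_of_mem {z : E → ℝ} (hz : H.netFlow z = 0) {q q' : ℂ} (hq : q ∈ H.region)
    (hq' : q' ∈ connectedComponentIn H.region q) : H.winding z q = H.winding z q' :=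
  isPreconnected_connectedComponentIn.induction₂ (fun x y => H.winding z x = H.winding z y)
    (fun _ hx => (H.winding_eventuallyEq hz
      (connectedComponentIn_subset _ _ hx)).filter_mono nhdsWithin_le_nhds)
    (fun _ _ _ _ _ _ h h' => h.trans h') (fun _ _ _ _ h => h.symm)
    (mem_connectedComponentIn hq) hq'

open Classical in
/-- The winding of a flow around the points of a face. -/
noncomputable def faceWinding (z : E → ℝ) (f : Set ℂ) : ℝ :=
  if h : f.Nonempty then H.winding z h.some else 0

lemma faceWinding_eq {z : E → ℝ} (hz : H.netFlow z = 0) {q : ℂ} (hq : q ∈ H.region) :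
    H.faceWinding z (connectedComponentIn H.region q) = H.winding z q := by
  have h : (connectedComponentIn H.region q).Nonempty := ⟨q, mem_connectedComponentIn hq⟩
  rw [faceWinding, dif_pos h]
  exact (H.winding_eq_of_mem hz hq h.some_mem).symm

/-- At a point inside `e` all other summands (`R`) are continuous; only the angle of `e` itself
jumps, from `-π` to `π`. -/
lemma faceWinding_side {z : E → ℝ} (hz : H.netFlow z = 0) (e : E) :
    H.faceWinding z (H.side e true) - H.faceWinding z (H.side e false) = 2 * Real.pi * z e := by
  classical
  obtain ⟨p, hp⟩ := H.openEdge_nonempty e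
  set R : ℂ → ℝ := fun q => ∑ e' ∈ Finset.univ.erase e,
    z e' * viewAngle (H.pos (H.src e')) (H.pos (H.tgt e')) q with hR
  have hRc : ContinuousAt R p := by
    refine tendsto_finsetSum _ fun e' he' => ?_
    refine tendsto_const_nhds.mul (continuousAt_viewAngle fun hmem => ?_)
    exact Set.disjoint_left.1 (H.openEdge_disjoint_closedEdge (Finset.ne_of_mem_erase he').symm)
      hp hmem
  have hsplit : ∀ q, H.winding z q =
      z e * viewAngle (H.pos (H.src e)) (H.pos (H.tgt e)) q + R q := fun q =>
    (Finset.add_sum_erase _ _ (Finset.mem_univ e)).symm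
  have hlim : ∀ (b : Bool) (c : ℝ), Tendsto (viewAngle (H.pos (H.src e)) (H.pos (H.tgt e)))
      (𝓝[H.half e (sgn b)] p) (𝓝 c) → H.faceWinding z (H.side e b) = z e * c + R p := by
    intro b c hc
    have := H.neBot_half e b hp
    have h1 : Tendsto (H.winding z) (𝓝[H.half e (sgn b)] p) (𝓝 (z e * c + R p)) := by
      simp only [funext hsplit]
      exact (tendsto_const_nhds.mul hc).add (hRc.tendsto.mono_left nhdsWithin_le_nhds)
    have h2 : Tendsto (H.winding z) (𝓝[H.half e (sgn b)] p)
        (𝓝 (H.faceWinding z (H.side e b))) := by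
      refine tendsto_const_nhds.congr' ?_
      filter_upwards [H.side_spec e b hp] with q hq
      rw [← hq.2, H.faceWinding_eq hz hq.1]
    exact tendsto_nhds_unique h2 h1
  have ht := tendsto_viewAngle (H.pos_src_ne e) hp
  rw [hlim true _ ht.1, hlim false _ ht.2]
  ring

/-- The flow and a constant determine a function on the faces. -/
noncomputable def potential :
    (LinearMap.ker H.netFlow × ℝ) →ₗ[ℝ] (H.faces → ℝ) where
  toFun x f := H.faceWinding x.1.1 f + x.2
  map_add' x y := by
    ext f
    simp only [faceWinding, winding, Prod.fst_add, Prod.snd_add, Submodule.coe_add, Pi.add_apply,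
      add_mul, Finset.sum_add_distrib]
    split_ifs <;> ring
  map_smul' c x := by
    ext f
    simp only [faceWinding, winding, Prod.smul_fst, Prod.smul_snd, Submodule.coe_smul,
      Pi.smul_apply, smul_eq_mul, RingHom.id_apply, mul_assoc, ← Finset.mul_sum]
    split_ifs <;> ring

/-- If all face values vanish, the jump across each edge gives `z e = 0`, and then the constant is
zero too. The extra real parameter accounts for one dimension in Euler's formula. -/
lemma potential_injective [Nonempty E] : Function.Injective H.potential := by
  rw [← LinearMap.ker_eq_bot, LinearMap.ker_eq_bot']
  rintro ⟨z, c⟩ h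
  have hz : z = 0 := by
    ext e
    have h1 := congrFun h ⟨_, H.side_mem_faces e true⟩
    have h2 := congrFun h ⟨_, H.side_mem_faces e false⟩
    simp only [potential, LinearMap.coe_mk, AddHom.coe_mk, Pi.zero_apply] at h1 h2
    have h3 := H.faceWinding_side z.2 e
    have h4 : 2 * Real.pi * z.1 e = 0 := by rw [← h3]; linarith
    exact (mul_eq_zero.1 h4).resolve_left Real.two_pi_pos.ne'
  subst hz
  have e : E := Classical.arbitrary E
  have h1 := congrFun h ⟨_, H.side_mem_faces e true⟩
  simp only [potential, LinearMap.coe_mk, AddHom.coe_mk, Pi.zero_apply] at h1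
  have : H.faceWinding (0 : E → ℝ) (H.side e true) = 0 := by
    simp [faceWinding, winding]
  simp only [Submodule.coe_zero, this, zero_add] at h1
  rw [h1]; rfl

/-- Half of Euler's formula: a plane graph has many faces. -/
lemma card_edges_add_two_le [Nonempty E] :
    Fintype.card E + 2 ≤ Fintype.card V + H.faces.card := by
  have h1 : Module.finrank ℝ (LinearMap.range H.netFlow) + 1 ≤ Fintype.card V := by
    let S : (V → ℝ) →ₗ[ℝ] ℝ := Fintype.linearCombination ℝ (fun _ : V => (1 : ℝ))
    have hS : ∀ g, S g = ∑ v, g v := fun g => by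
      simp [S, Fintype.linearCombination_apply]
    -- Net inflows add up to zero over all vertices, so they lie in a hyperplane.
    have hle : LinearMap.range H.netFlow ≤ LinearMap.ker S := by
      rintro _ ⟨z, rfl⟩
      rw [LinearMap.mem_ker, hS]
      have := H.sum_netFlow_mul z fun _ => 1
      simpa using this
    have h2 := LinearMap.finrank_range_add_finrank_ker S
    have h3 : LinearMap.range S = ⊤ := by
      classical
      rw [LinearMap.range_eq_top]
      intro c
      have e : E := Classical.arbitrary E
      exact ⟨Pi.single (H.src e) c, by rw [hS]; simp⟩
    rw [h3, finrank_top, Module.finrank_self, Module.finrank_fintype_fun_eq_card] at h2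
    have := Submodule.finrank_mono hle
    omega
  have h2 := LinearMap.finrank_range_add_finrank_ker H.netFlow
  have h3 := LinearMap.finrank_le_finrank_of_injective H.potential_injective
  rw [Module.finrank_prod, Module.finrank_self, Module.finrank_fintype_fun_eq_card,
    Fintype.card_coe] at h3
  rw [Module.finrank_fintype_fun_eq_card] at h2
  omega

/-- The consequence of Euler's formula for weighted edges in which the edges bounding a face have
weight at least `g`. -/
theorem euler_bound (w : E → ℕ) (g : ℕ)
    (hg : ∀ S : Set E, S.Nonempty →
      (∀ e ∈ S, ∀ v, H.Inc e v → ∃ e' ∈ S, e' ≠ e ∧ H.Inc e' v) →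
      ∃ T : Finset E, (T : Set E) ⊆ S ∧ g ≤ ∑ e ∈ T, w e) [Nonempty E] :
    Fintype.card E + 1 ≤ Fintype.card V ∨
      g * (Fintype.card E + 2) ≤ 2 * ∑ e, w e + g * Fintype.card V := by
  classical
  have hF := H.card_edges_add_two_le
  -- A face bounded by no edge is the only face, which gives the first alternative. Otherwise each
  -- face contributes weight at least `g`, and each edge bounds at most its two sides.
  by_cases hex : ∃ f ∈ H.faces, ∀ e, ¬ H.Bounds e f
  · left
    obtain ⟨f, hf, hb⟩ := hex
    obtain ⟨⟨e₀, b₀⟩, -, rfl⟩ := Finset.mem_image.1 hf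
    have : H.faces.card ≤ 1 := by
      rw [Finset.card_le_one]
      intro a ha b hb'
      obtain ⟨⟨e, c⟩, -, rfl⟩ := Finset.mem_image.1 ha
      obtain ⟨⟨e', c'⟩, -, rfl⟩ := Finset.mem_image.1 hb'
      exact (H.side_eq_of_forall_not_bounds hb e c).trans
        (H.side_eq_of_forall_not_bounds hb e' c').symm
    omega
  · right
    push Not at hex
    have h1 : ∀ f ∈ H.faces, g ≤ ∑ e, if H.Bounds e f then w e else 0 := by
      intro f hf
      obtain ⟨e, he⟩ := hex f hf
      obtain ⟨T, hT, hgT⟩ := hg {e | H.Bounds e f} ⟨e, he⟩ (by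
        intro e he v hv
        obtain ⟨e', h1, h2, h3⟩ := H.exists_bounds_ne he hv
        exact ⟨e', h2, h1, h3⟩)
      refine hgT.trans ?_
      rw [← Finset.sum_filter]
      exact Finset.sum_le_sum_of_subset fun e he => Finset.mem_filter.2 ⟨Finset.mem_univ _, hT he⟩
    have h2 : ∀ e, ∑ f ∈ H.faces, (if H.Bounds e f then w e else 0) ≤ 2 * w e := by
      intro e
      rw [← Finset.sum_filter, Finset.sum_const, smul_eq_mul]
      refine Nat.mul_le_mul_right _ ?_
      refine (Finset.card_le_card (t := {H.side e true, H.side e false}) fun f hf => ?_).trans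
        Finset.card_le_two
      have := (Finset.mem_filter.1 hf).2
      unfold Bounds at this
      simp only [Finset.mem_insert, Finset.mem_singleton]
      by_contra hcon
      push Not at hcon
      exact this ⟨fun h => absurd h.symm hcon.1, fun h => absurd h.symm hcon.2⟩
    have h3 : H.faces.card * g ≤ 2 * ∑ e, w e := by
      calc H.faces.card * g = ∑ _f ∈ H.faces, g := by simp
        _ ≤ ∑ f ∈ H.faces, ∑ e, (if H.Bounds e f then w e else 0) := Finset.sum_le_sum h1
        _ = ∑ e, ∑ f ∈ H.faces, (if H.Bounds e f then w e else 0) := Finset.sum_comm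
        _ ≤ ∑ e, 2 * w e := Finset.sum_le_sum fun e _ => h2 e
        _ = 2 * ∑ e, w e := by rw [Finset.mul_sum]
    calc g * (Fintype.card E + 2) ≤ g * (Fintype.card V + H.faces.card) :=
          Nat.mul_le_mul_left _ hF
      _ = H.faces.card * g + g * Fintype.card V := by ring
      _ ≤ _ := by omega

end StraightPlaneGraph
-- Polygonal arcs and cutting them at an interior point.
namespace PolygonalArc

variable (A : PolygonalArc)

lemma eq_of_mem_segments {i j : ℕ} (hij : i < j) (hj : j < A.len) {x : Plane}
    (hi : x ∈ segment ℝ (A.pt i) (A.pt (i + 1))) (hx : x ∈ segment ℝ (A.pt j) (A.pt (j + 1))) :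
    j = i + 1 ∧ x = A.pt j := by
  rcases (Nat.succ_le_of_lt hij).eq_or_lt with rfl | h
  · refine ⟨rfl, ?_⟩
    have : x ∈ segment ℝ (A.pt i) (A.pt (i + 1)) ∩ segment ℝ (A.pt (i + 1)) (A.pt (i + 2)) :=
      ⟨hi, hx⟩
    rw [A.consecutive i hj] at this
    exact this
  · exact absurd hx (Set.disjoint_left.1 (A.far i j h hj) hi)

lemma pt_ne_of_lt {a b : ℕ} (hab : a < b) (hb : b ≤ A.len) : A.pt a ≠ A.pt b := by
  intro h
  obtain ⟨c, rfl⟩ : ∃ c, b = c + 1 := ⟨b - 1, by omega⟩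
  rcases (Nat.lt_succ_iff.1 hab).eq_or_lt with rfl | hac
  · exact A.pt_ne a (by omega) h
  · obtain ⟨rfl, h2⟩ := A.eq_of_mem_segments (x := A.pt a) hac (by omega)
      (left_mem_segment ℝ _ _) (h ▸ right_mem_segment ℝ _ _)
    exact A.pt_ne a (by omega) h2

lemma pt_injOn {a b : ℕ} (ha : a ≤ A.len) (hb : b ≤ A.len) (h : A.pt a = A.pt b) : a = b := by
  rcases lt_trichotomy a b with hab | hab | hab
  · exact absurd h (A.pt_ne_of_lt hab hb)
  · exact hab
  · exact absurd h.symm (A.pt_ne_of_lt hab ha)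

lemma source_ne_target : A.source ≠ A.target := A.pt_ne_of_lt A.len_pos le_rfl

lemma pt_notMem_openSegment {a i : ℕ} (ha : a ≤ A.len) (hi : i < A.len) :
    A.pt a ∉ openSegment ℝ (A.pt i) (A.pt (i + 1)) := by
  intro h
  have hs := openSegment_subset_segment ℝ _ _ h
  rcases lt_trichotomy a i with hai | rfl | hai
  · have := A.eq_of_mem_segments hai hi (left_mem_segment ℝ _ _) hs
    exact A.pt_ne_of_lt hai hi.le this.2
  · exact A.pt_ne a hi (left_mem_openSegment_iff.1 h)
  · obtain ⟨c, rfl⟩ : ∃ c, a = c + 1 := ⟨a - 1, by omega⟩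
    rcases (Nat.lt_succ_iff.1 hai).eq_or_lt with rfl | hac
    · exact A.pt_ne i hi (right_mem_openSegment_iff.1 h)
    · have := A.eq_of_mem_segments hac (by omega) hs (right_mem_segment ℝ _ _)
      exact A.pt_ne c (by omega) this.2.symm

lemma disjoint_openSegments {i j : ℕ} (hi : i < A.len) (hj : j < A.len) (hij : i ≠ j) :
    Disjoint (openSegment ℝ (A.pt i) (A.pt (i + 1))) (openSegment ℝ (A.pt j) (A.pt (j + 1))) := by
  wlog h : i < j generalizing i j
  · exact (this hj hi hij.symm (by omega)).symm
  rw [Set.disjoint_left]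
  intro x hx hy
  obtain ⟨-, rfl⟩ := A.eq_of_mem_segments h hj (openSegment_subset_segment ℝ _ _ hx)
    (openSegment_subset_segment ℝ _ _ hy)
  exact A.pt_notMem_openSegment hj.le hi hx

lemma mem_carrier {x : Plane} :
    x ∈ A.carrier ↔ ∃ i < A.len, x ∈ segment ℝ (A.pt i) (A.pt (i + 1)) := by
  simp [carrier]

lemma openSegment_subset_inner {i : ℕ} (hi : i < A.len) :
    openSegment ℝ (A.pt i) (A.pt (i + 1)) ⊆ A.inner := by
  intro x hx
  refine ⟨A.mem_carrier.2 ⟨i, hi, openSegment_subset_segment ℝ _ _ hx⟩, ?_⟩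
  rintro (rfl | rfl)
  · exact A.pt_notMem_openSegment (Nat.zero_le _) hi hx
  · exact A.pt_notMem_openSegment le_rfl hi hx

lemma pt_mem_inner {a : ℕ} (h0 : 0 < a) (ha : a < A.len) : A.pt a ∈ A.inner := by
  refine ⟨A.mem_carrier.2 ⟨a, ha, left_mem_segment ℝ _ _⟩, ?_⟩
  rintro (h | h)
  · exact A.pt_ne_of_lt h0 ha.le h.symm
  · exact A.pt_ne_of_lt ha le_rfl h

lemma source_mem_carrier : A.source ∈ A.carrier :=
  A.mem_carrier.2 ⟨0, A.len_pos, left_mem_segment ℝ _ _⟩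

lemma target_mem_carrier : A.target ∈ A.carrier := by
  obtain ⟨c, hc⟩ : ∃ c, A.len = c + 1 := ⟨A.len - 1, by have := A.len_pos; omega⟩
  refine A.mem_carrier.2 ⟨c, by omega, ?_⟩
  rw [target, hc]; exact right_mem_segment ℝ _ _

/-- A polygonal arc each segment of which is contained in the corresponding segment of `A`. -/
def subarc (m n : ℕ) (q : ℕ → Plane) (hn : 0 < n) (hmn : m + n ≤ A.len)
    (hq : ∀ j, 0 < j → j < n → q j = A.pt (m + j)) (hne : ∀ j < n, q j ≠ q (j + 1))
    (hsub : ∀ j < n, segment ℝ (q j) (q (j + 1)) ⊆ segment ℝ (A.pt (m + j)) (A.pt (m + j + 1))) :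
    PolygonalArc where
  len := n
  len_pos := hn
  pt := q
  pt_ne := hne
  consecutive i hi := by
    apply Subset.antisymm
    · intro x hx
      have := A.consecutive (m + i) (by omega)
      rw [hq (i + 1) (by omega) hi, mem_singleton_iff]
      have h2 : x ∈ ({A.pt (m + i + 1)} : Set Plane) := by
        rw [← this]
        exact ⟨hsub i (by omega) hx.1, hsub (i + 1) hi hx.2⟩
      exact h2
    · rintro x rfl
      exact ⟨right_mem_segment ℝ _ _, left_mem_segment ℝ _ _⟩
  far i j hij hj := (A.far (m + i) (m + j) (by omega) (by omega)).mono (hsub i (by omega))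
    (hsub j hj)

lemma segment_inter_eq {a b c x : Plane} (hc : c ∈ segment ℝ a b) (h1 : x ∈ segment ℝ a c)
    (h2 : x ∈ segment ℝ c b) : x = c := by
  rw [mem_segment_iff_wbtw] at *
  exact (wbtw_swap_left_iff ℝ b).1 ⟨hc.trans_left_right h1, h2⟩

/-- An interior point cuts a polygonal arc into two polygonal arcs. -/
lemma exists_split {c : Plane} (hc : c ∈ A.inner) : ∃ A₁ A₂ : PolygonalArc,
    A₁.source = A.source ∧ A₁.target = c ∧ A₂.source = c ∧ A₂.target = A.target ∧
    A₁.inner ⊆ A.inner \ {c} ∧ A₂.inner ⊆ A.inner \ {c} ∧ Disjoint A₁.inner A₂.inner := by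
  obtain ⟨hcar, hends⟩ := hc
  simp only [mem_insert_iff, mem_singleton_iff, not_or] at hends
  -- Segment `i` becomes the last one of the first part, so `c` must differ from its start. Segment
  -- `m` below becomes the first one of the second part, so `c` must differ from its end; `m = i`
  -- unless `c` is a bend, when `m = i + 1`.
  obtain ⟨i, hi, hci, hcne⟩ :
      ∃ i < A.len, c ∈ segment ℝ (A.pt i) (A.pt (i + 1)) ∧ c ≠ A.pt i := by
    obtain ⟨i, hi, hci⟩ := A.mem_carrier.1 hcar
    by_cases h : c = A.pt i
    · obtain ⟨j, rfl⟩ : ∃ j, i = j + 1 := by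
        rcases Nat.eq_zero_or_pos i with rfl | h0
        · exact absurd h hends.1
        · exact ⟨i - 1, by omega⟩
      exact ⟨j, by omega, h ▸ right_mem_segment ℝ _ _, fun h' => A.pt_ne j (by omega) (h'.symm.trans h)⟩
    · exact ⟨i, hi, hci, h⟩
  obtain ⟨m, hm, hcm, hcne', hmi⟩ : ∃ m < A.len, c ∈ segment ℝ (A.pt m) (A.pt (m + 1)) ∧
      c ≠ A.pt (m + 1) ∧ (m = i ∨ m = i + 1 ∧ c = A.pt (i + 1)) := by
    by_cases h : c = A.pt (i + 1)
    · have : i + 1 < A.len := by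
        rcases (Nat.succ_le_of_lt hi).eq_or_lt with h' | h'
        · exact absurd (h'.subst (motive := fun t => c = A.pt t) h) hends.2
        · exact h'
      exact ⟨i + 1, this, h ▸ left_mem_segment ℝ _ _, h ▸ A.pt_ne _ this, Or.inr ⟨rfl, h⟩⟩
    · exact ⟨i, hi, hci, h, Or.inl rfl⟩
  have hsub1 : ∀ j < i + 1, segment ℝ (if j ≤ i then A.pt j else c)
      (if j + 1 ≤ i then A.pt (j + 1) else c) ⊆ segment ℝ (A.pt (0 + j)) (A.pt (0 + j + 1)) := by
    intro j hj
    rw [if_pos (by omega), zero_add]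
    by_cases h : j + 1 ≤ i
    · rw [if_pos h]
    · rw [if_neg h]
      obtain rfl : j = i := by omega
      exact (convex_segment _ _).segment_subset (left_mem_segment ℝ _ _) hci
  have hsub2 : ∀ j < A.len - m, segment ℝ (if j = 0 then c else A.pt (m + j))
      (if j + 1 = 0 then c else A.pt (m + (j + 1))) ⊆
      segment ℝ (A.pt (m + j)) (A.pt (m + j + 1)) := by
    intro j hj
    rw [if_neg (Nat.succ_ne_zero j)]
    by_cases h : j = 0
    · subst h
      exact (convex_segment _ _).segment_subset hcm (right_mem_segment ℝ _ _)
    · rw [if_neg h]; rfl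
  let A₁ := A.subarc 0 (i + 1) (fun j => if j ≤ i then A.pt j else c) (by omega) (by omega)
    (fun j _ h => by rw [zero_add, if_pos (by omega)])
    (fun j hj => by
      rw [if_pos (by omega)]
      by_cases h : j + 1 ≤ i
      · rw [if_pos h]; exact A.pt_ne j (by omega)
      · rw [if_neg h]
        obtain rfl : j = i := by omega
        exact hcne.symm) hsub1
  let A₂ := A.subarc m (A.len - m) (fun j => if j = 0 then c else A.pt (m + j)) (by omega)
    (by omega) (fun j h _ => by rw [if_neg (by omega)])
    (fun j hj => by
      rw [if_neg (Nat.succ_ne_zero j)]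
      by_cases h : j = 0
      · subst h; exact hcne'
      · rw [if_neg h]; exact A.pt_ne (m + j) (by omega)) hsub2
  have e1 : A₁.source = A.source := by
    change (if 0 ≤ i then A.pt 0 else c) = A.pt 0
    exact if_pos (Nat.zero_le i)
  have e2 : A₁.target = c := by
    change (if i + 1 ≤ i then A.pt (i + 1) else c) = c
    exact if_neg (Nat.not_succ_le_self i)
  have e3 : A₂.source = c := by
    change (if 0 = 0 then c else A.pt (m + 0)) = c
    exact if_pos rfl
  have e4 : A₂.target = A.target := by
    change (if A.len - m = 0 then c else A.pt (m + (A.len - m))) = A.target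
    rw [if_neg (by omega), Nat.add_sub_cancel' hm.le]; rfl
  have hc1 : A₁.carrier ⊆ A.carrier := by
    intro x hx
    obtain ⟨j, hj, hx⟩ := A₁.mem_carrier.1 hx
    have hj' : j < i + 1 := hj
    exact A.mem_carrier.2 ⟨0 + j, by omega, hsub1 j hj hx⟩
  have hc2 : A₂.carrier ⊆ A.carrier := by
    intro x hx
    obtain ⟨j, hj, hx⟩ := A₂.mem_carrier.1 hx
    have hj' : j < A.len - m := hj
    exact A.mem_carrier.2 ⟨m + j, by omega, hsub2 j hj hx⟩
  have hint : ∀ x ∈ A₁.carrier, x ∈ A₂.carrier → x = c := by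
    intro x hx hx'
    obtain ⟨j, hj, hx⟩ := A₁.mem_carrier.1 hx
    obtain ⟨l, hl, hx'⟩ := A₂.mem_carrier.1 hx'
    have hj' : j < i + 1 := hj
    have hl' : l < A.len - m := hl
    have hxj := hsub1 j hj hx
    have hxl := hsub2 l hl hx'
    rw [zero_add] at hxj
    have hx1 : j = i → x ∈ segment ℝ (A.pt i) c := by
      rintro rfl
      have h : x ∈ segment ℝ (if j ≤ j then A.pt j else c)
        (if j + 1 ≤ j then A.pt (j + 1) else c) := hx
      rwa [if_pos le_rfl, if_neg (by omega)] at h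
    by_cases hlt : j < m + l
    · obtain ⟨h1, h2⟩ := A.eq_of_mem_segments hlt (by omega) hxj hxl
      rcases hmi with rfl | ⟨hmi, hce⟩
      · rcases Nat.eq_zero_or_pos l with rfl | hl0
        · have h : x ∈ segment ℝ c (A.pt (m + (0 + 1))) := hx'
          rw [h2] at h ⊢
          exact segment_inter_eq hci (left_mem_segment ℝ _ _) h
        · obtain rfl : j = m := by omega
          rw [h2, h1]
          rw [h2, h1] at hx1
          exact segment_inter_eq hci (hx1 rfl) (right_mem_segment ℝ _ _)
      · rw [h2, hce]; congr 1; omega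
    · obtain ⟨rfl, rfl, rfl⟩ : l = 0 ∧ m = i ∧ j = i := by omega
      have h : x ∈ segment ℝ c (A.pt (j + (0 + 1))) := hx'
      exact segment_inter_eq hci (hx1 rfl) h
  refine ⟨A₁, A₂, e1, e2, e3, e4, ?_, ?_, ?_⟩
  · rintro x ⟨hx, hne⟩
    rw [e1, e2] at hne
    simp only [mem_insert_iff, mem_singleton_iff, not_or] at hne
    refine ⟨⟨hc1 hx, ?_⟩, hne.2⟩
    rintro (h | h)
    · exact hne.1 h
    · exact hne.2 (hint x hx (h ▸ e4 ▸ A₂.target_mem_carrier))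
  · rintro x ⟨hx, hne⟩
    rw [e3, e4] at hne
    simp only [mem_insert_iff, mem_singleton_iff, not_or] at hne
    refine ⟨⟨hc2 hx, ?_⟩, hne.1⟩
    rintro (h | h)
    · exact hne.1 (hint x (h ▸ e1 ▸ A₁.source_mem_carrier) hx)
    · exact hne.2 h
  · rw [Set.disjoint_left]
    intro x hx hx'
    have := hint x hx.1 hx'.1
    exact hx.2 (Or.inr (this.trans e2.symm))

end PolygonalArc

/-! ### Plane graphs with polygonal edges, reduced to straight ones. -/

/-- A (multi)graph drawn in the plane with polygonal arcs that do not cross. -/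
structure PlaneArcSystem (V ι : Type*) where
  vert : V → Plane
  src : ι → V
  tgt : ι → V
  arc : ι → PolygonalArc
  vert_injective : Function.Injective vert
  arc_source : ∀ i, (arc i).source = vert (src i)
  arc_target : ∀ i, (arc i).target = vert (tgt i)
  vert_notMem : ∀ i v, vert v ∉ (arc i).inner
  disjoint : ∀ i j, i ≠ j → Disjoint (arc i).inner (arc j).inner

namespace PlaneArcSystem

variable {V ι : Type*} (P : PlaneArcSystem V ι)

/-- The vertex `v` is an end of the arc `i`. -/
def Inc (i : ι) (v : V) : Prop := P.src i = v ∨ P.tgt i = v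

lemma src_ne_tgt (i : ι) : P.src i ≠ P.tgt i := by
  intro h
  apply (P.arc i).source_ne_target
  rw [P.arc_source, P.arc_target, h]

/-- Vertices and bends. -/
abbrev Node : Type _ := V ⊕ Σ i, Fin ((P.arc i).len - 1)

/-- The position of a vertex or a bend. -/
def point : P.Node → Plane
  | Sum.inl v => P.vert v
  | Sum.inr x => (P.arc x.1).pt (x.2 + 1)

/-- The `j`-th node on the arc `i`. -/
def node (i : ι) (j : ℕ) : P.Node :=
  if j = 0 then Sum.inl (P.src i)
  else if h : j - 1 < (P.arc i).len - 1 then Sum.inr ⟨i, ⟨j - 1, h⟩⟩ else Sum.inl (P.tgt i)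

lemma point_node {i : ι} {j : ℕ} (hj : j ≤ (P.arc i).len) :
    P.point (P.node i j) = (P.arc i).pt j := by
  unfold node
  split_ifs with h0 h1
  · subst h0; exact (P.arc_source i).symm
  · simp only [point]; congr 1; omega
  · obtain rfl : j = (P.arc i).len := by omega
    exact (P.arc_target i).symm

lemma node_eq_inr {i : ι} {j : ℕ} {x : Σ i, Fin ((P.arc i).len - 1)}
    (h : P.node i j = Sum.inr x) : i = x.1 ∧ j = x.2 + 1 := by
  unfold node at h
  split_ifs at h with h0 h1
  obtain rfl := Sum.inr_injective h
  exact ⟨rfl, by simp only; omega⟩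

lemma node_eq_inl {i : ι} {j : ℕ} {v : V} (h : P.node i j = Sum.inl v) (hj : j ≤ (P.arc i).len) :
    j = 0 ∧ P.src i = v ∨ j = (P.arc i).len ∧ P.tgt i = v := by
  unfold node at h
  split_ifs at h with h0 h1
  · exact Or.inl ⟨h0, Sum.inl_injective h⟩
  · exact Or.inr ⟨by omega, Sum.inl_injective h⟩

lemma node_zero (i : ι) : P.node i 0 = Sum.inl (P.src i) := if_pos rfl

lemma node_len (i : ι) : P.node i (P.arc i).len = Sum.inl (P.tgt i) := by
  have := (P.arc i).len_pos
  rw [node, if_neg (by omega), dif_neg (by omega)]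

lemma node_succ {i : ι} {j : ℕ} (hj : j + 1 < (P.arc i).len) :
    P.node i (j + 1) = Sum.inr ⟨i, ⟨j, by omega⟩⟩ := by
  rw [node, if_neg (by omega), dif_pos (by omega)]
  rfl

lemma node_ne_node {i : ι} {j : ℕ} (hj : j < (P.arc i).len) : P.node i j ≠ P.node i (j + 1) := by
  intro h
  apply (P.arc i).pt_ne j hj
  rw [← P.point_node hj.le, ← P.point_node (Nat.succ_le_of_lt hj), h]

lemma inr_mem_inner (x : Σ i, Fin ((P.arc i).len - 1)) :
    P.point (Sum.inr x) ∈ (P.arc x.1).inner :=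
  (P.arc x.1).pt_mem_inner (Nat.succ_pos _) (by have := x.2.2; omega)

lemma point_injective : Function.Injective P.point := by
  have key : ∀ (v : V) x, P.point (Sum.inl v) ≠ P.point (Sum.inr x) := fun v x h =>
    P.vert_notMem x.1 v (by
      have : P.vert v = P.point (Sum.inr x) := h
      rw [this]; exact P.inr_mem_inner x)
  rintro (u | x) (v | y) h
  · exact congrArg _ (P.vert_injective h)
  · exact absurd h (key u y)
  · exact absurd h.symm (key v x)
  · have hxy : x.1 = y.1 := by
      by_contra hne
      exact Set.disjoint_left.1 (P.disjoint _ _ hne) (P.inr_mem_inner x) (h ▸ P.inr_mem_inner y)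
    obtain ⟨i, a⟩ := x
    obtain ⟨j, b⟩ := y
    obtain rfl : i = j := hxy
    have ha := a.2
    have hb := b.2
    have : (a : ℕ) + 1 = b + 1 := (P.arc i).pt_injOn (by omega) (by omega) h
    obtain rfl : a = b := Fin.ext (by omega)
    rfl

lemma point_notMem (i : ι) {j : ℕ} (hj : j < (P.arc i).len) (x : P.Node) :
    P.point x ∉ openSegment ℝ ((P.arc i).pt j) ((P.arc i).pt (j + 1)) := by
  intro h
  have hin := (P.arc i).openSegment_subset_inner hj h
  rcases x with v | x
  · exact P.vert_notMem i v hin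
  · have hxi : x.1 = i := by
      by_contra hne
      exact Set.disjoint_left.1 (P.disjoint _ _ hne) (P.inr_mem_inner x) hin
    subst hxi
    exact (P.arc x.1).pt_notMem_openSegment (by have := x.2.2; omega) hj h

lemma image_openSegment (i : ι) {j : ℕ} (hj : j < (P.arc i).len) :
    openSegment ℝ (Complex.equivRealProdCLM.symm (P.point (P.node i j)))
      (Complex.equivRealProdCLM.symm (P.point (P.node i (j + 1)))) =
    Complex.equivRealProdCLM.symm ''
      openSegment ℝ ((P.arc i).pt j) ((P.arc i).pt (j + 1)) := by
  rw [P.point_node hj.le, P.point_node (Nat.succ_le_of_lt hj)]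
  exact (_root_.image_openSegment ℝ
    Complex.equivRealProdCLM.symm.toLinearEquiv.toLinearMap.toAffineMap _ _).symm

/-- The plane graph whose edges are the segments of the arcs. -/
noncomputable def toStraight : StraightPlaneGraph P.Node (Σ i, Fin (P.arc i).len) where
  pos x := Complex.equivRealProdCLM.symm (P.point x)
  src e := P.node e.1 e.2
  tgt e := P.node e.1 (e.2 + 1)
  pos_injective := Complex.equivRealProdCLM.symm.injective.comp P.point_injective
  src_ne_tgt e := P.node_ne_node e.2.2
  pos_notMem e x := by
    rw [P.image_openSegment e.1 e.2.2,
      Complex.equivRealProdCLM.symm.injective.mem_set_image]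
    exact P.point_notMem e.1 e.2.2 x
  disjoint e e' h := by
    rw [P.image_openSegment e.1 e.2.2, P.image_openSegment e'.1 e'.2.2,
      Set.disjoint_image_iff Complex.equivRealProdCLM.symm.injective]
    obtain ⟨i, a⟩ := e
    obtain ⟨j, b⟩ := e'
    by_cases hij : i = j
    · subst hij
      exact (P.arc i).disjoint_openSegments a.2 b.2 fun hab => h (congrArg _ (Fin.ext hab))
    · exact (P.disjoint i j hij).mono ((P.arc i).openSegment_subset_inner a.2)
        ((P.arc j).openSegment_subset_inner b.2)

lemma inc_inr {e : Σ i, Fin (P.arc i).len} {x : Σ i, Fin ((P.arc i).len - 1)}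
    (h : P.toStraight.Inc e (Sum.inr x)) :
    e.1 = x.1 ∧ ((e.2 : ℕ) = x.2 + 1 ∨ (e.2 : ℕ) = x.2) := by
  rcases h with h | h
  · obtain ⟨h1, h2⟩ := P.node_eq_inr h
    exact ⟨h1, Or.inl h2⟩
  · obtain ⟨h1, h2⟩ := P.node_eq_inr (i := e.1) (j := e.2 + 1) h
    exact ⟨h1, Or.inr (by omega)⟩

lemma inc_inl {e : Σ i, Fin (P.arc i).len} {v : V} (h : P.toStraight.Inc e (Sum.inl v)) :
    (e.2 : ℕ) = 0 ∧ P.src e.1 = v ∨ (e.2 : ℕ) + 1 = (P.arc e.1).len ∧ P.tgt e.1 = v := by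
  have := e.2.2
  rcases h with h | h
  · rcases P.node_eq_inl h (by omega) with h | h
    · exact Or.inl h
    · omega
  · rcases P.node_eq_inl (i := e.1) (j := e.2 + 1) h (by omega) with h | h
    · omega
    · exact Or.inr h

/-- The first segment of an arc. -/
def first (i : ι) : Σ i, Fin (P.arc i).len := ⟨i, ⟨0, (P.arc i).len_pos⟩⟩

/-- A set of segments without vertices of degree one consists of whole arcs. -/
lemma mem_iff_first_mem {S : Set (Σ i, Fin (P.arc i).len)}
    (hS : ∀ e ∈ S, ∀ v, P.toStraight.Inc e v → ∃ e' ∈ S, e' ≠ e ∧ P.toStraight.Inc e' v)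
    {i : ι} {j : ℕ} (hj : j < (P.arc i).len) : (⟨i, ⟨j, hj⟩⟩ : Σ i, Fin (P.arc i).len) ∈ S ↔ P.first i ∈ S := by
  induction j with
  | zero => rfl
  | succ j ih =>
    have hj' : j < (P.arc i).len := by omega
    rw [← ih hj']
    have hx : P.node i (j + 1) = Sum.inr ⟨i, ⟨j, by omega⟩⟩ := P.node_succ hj
    constructor
    · intro h
      obtain ⟨⟨i', a⟩, he', hne, hinc⟩ := hS _ h (Sum.inr ⟨i, ⟨j, by omega⟩⟩) (Or.inl hx)
      obtain ⟨h1, h2⟩ := P.inc_inr hinc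
      obtain rfl : i' = i := h1
      rcases h2 with h2 | h2
      · exact absurd (congrArg _ (Fin.ext h2)) hne
      · rwa [show a = ⟨j, hj'⟩ from Fin.ext h2] at he'
    · intro h
      obtain ⟨⟨i', a⟩, he', hne, hinc⟩ := hS _ h (Sum.inr ⟨i, ⟨j, by omega⟩⟩) (Or.inr hx)
      obtain ⟨h1, h2⟩ := P.inc_inr hinc
      obtain rfl : i' = i := h1
      rcases h2 with h2 | h2
      · rwa [show a = ⟨j + 1, hj⟩ from Fin.ext h2] at he'
      · exact absurd (congrArg _ (Fin.ext h2)) hne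

/-- The edge bound for plane graphs in which every subgraph of minimum degree two has at least `g`
edges. -/
theorem euler_bound [Fintype V] [Fintype ι] [Nonempty ι] (g : ℕ)
    (hg : ∀ T : Finset ι, T.Nonempty →
      (∀ i ∈ T, ∀ v, P.Inc i v → ∃ j ∈ T, j ≠ i ∧ P.Inc j v) → g ≤ T.card) :
    Fintype.card ι + 1 ≤ Fintype.card V ∨
      g * (Fintype.card ι + 2) ≤ 2 * Fintype.card ι + g * Fintype.card V := by
  classical
  have hne : Nonempty (Σ i, Fin (P.arc i).len) := ⟨P.first (Classical.arbitrary ι)⟩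
  have hinj : Function.Injective P.first := fun i j h => congrArg Sigma.fst h
  -- Weight one on the first segment of each arc and zero elsewhere makes the total weight of whole
  -- arcs equal to their number.
  have key := P.toStraight.euler_bound (fun e => if (e.2 : ℕ) = 0 then 1 else 0) g ?_
  · have hw : ∑ e : Σ i, Fin (P.arc i).len, (if (e.2 : ℕ) = 0 then 1 else 0) = Fintype.card ι := by
      rw [Fintype.sum_sigma]
      rw [Fintype.card_eq_sum_ones]
      refine Finset.sum_congr rfl fun i _ => ?_
      rw [Finset.sum_eq_single ⟨0, (P.arc i).len_pos⟩]
      · simp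
      · intro b _ hb
        exact if_neg fun h => hb (Fin.ext h)
      · simp
    have hc : Fintype.card (Σ i, Fin (P.arc i).len) =
        Fintype.card (Σ i, Fin ((P.arc i).len - 1)) + Fintype.card ι := by
      rw [Fintype.card_sigma, Fintype.card_sigma, Fintype.card_eq_sum_ones (α := ι),
        ← Finset.sum_add_distrib]
      refine Finset.sum_congr rfl fun i _ => ?_
      have := (P.arc i).len_pos
      simp only [Fintype.card_fin]
      omega
    rw [hw, hc, Fintype.card_sum] at key
    -- Each bend adds one vertex and one edge, so bends cancel from both alternatives.
    rcases key with key | key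
    · left; omega
    · right; nlinarith
  · intro S ⟨⟨i₀, a₀⟩, he₀⟩ hS
    set T : Finset ι := Finset.univ.filter fun i => P.first i ∈ S with hT
    have hmem : ∀ (e : Σ i, Fin (P.arc i).len), e ∈ S ↔ e.1 ∈ T := fun e => by
      rw [hT, Finset.mem_filter, ← P.mem_iff_first_mem hS e.2.2]
      simp
    refine ⟨T.image P.first, ?_, ?_⟩
    · intro e he
      obtain ⟨i, hi, rfl⟩ := Finset.mem_image.1 (Finset.mem_coe.1 he)
      exact (Finset.mem_filter.1 hi).2
    · rw [Finset.sum_image fun i _ j _ h => hinj h]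
      simp only [first, if_true, Finset.sum_const, smul_eq_mul, mul_one]
      refine hg T ⟨i₀, (hmem _).1 he₀⟩ fun i hi v hv => ?_
      have hpos := (P.arc i).len_pos
      obtain ⟨e, he1, he2⟩ : ∃ e : Σ i, Fin (P.arc i).len, e.1 = i ∧
          P.toStraight.Inc e (Sum.inl v) := by
        rcases hv with rfl | rfl
        · exact ⟨P.first i, rfl, Or.inl (P.node_zero i)⟩
        · refine ⟨⟨i, ⟨(P.arc i).len - 1, by omega⟩⟩, rfl, Or.inr ?_⟩
          change P.node i ((P.arc i).len - 1 + 1) = _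
          rw [Nat.sub_add_cancel hpos, P.node_len]
      subst he1
      obtain ⟨e', he', hne', hinc⟩ := hS e ((hmem e).2 hi) _ he2
      have h1 := P.inc_inl he2
      have h2 := P.inc_inl hinc
      refine ⟨e'.1, (hmem e').1 he', fun hee => ?_, ?_⟩
      · obtain ⟨i, a⟩ := e
        obtain ⟨j, b⟩ := e'
        obtain rfl : j = i := hee
        have hst := P.src_ne_tgt j
        rcases h1 with ⟨h1, h1'⟩ | ⟨h1, h1'⟩ <;> rcases h2 with ⟨h2, h2'⟩ | ⟨h2, h2'⟩
        · exact hne' (congrArg _ (Fin.ext (h2.trans h1.symm)))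
        · exact hst (h1'.trans h2'.symm)
        · exact hst (h2'.trans h1'.symm)
        · exact hne' (congrArg _ (Fin.ext (Nat.succ_injective (h2.trans h1.symm))))
      · rcases h2 with h2 | h2
        · exact Or.inl h2.2
        · exact Or.inr h2.2

end PlaneArcSystem
-- Edges and crossings of a 1-planar drawing.
namespace OnePlanarDrawing

variable {V : Type*} {G : SimpleGraph V} (D : OnePlanarDrawing G)

lemma exists_ends (e : G.edgeSet) : ∃ x y, (D.arc e).source = D.vert x ∧
    (D.arc e).target = D.vert y ∧ (e : Sym2 V) = s(x, y) := by
  obtain ⟨e, he⟩ := e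
  induction e using Sym2.ind with
  | _ a b =>
    have h := D.arc_ends ⟨s(a, b), he⟩
    rw [Sym2.map_mk, Sym2.eq_iff] at h
    rcases h with ⟨h1, h2⟩ | ⟨h1, h2⟩
    · exact ⟨a, b, h1, h2, rfl⟩
    · exact ⟨b, a, h1, h2, Sym2.eq_swap⟩

/-- The vertex at which the arc of `e` starts. -/
noncomputable def src (e : G.edgeSet) : V := (D.exists_ends e).choose

/-- The vertex at which the arc of `e` ends. -/
noncomputable def tgt (e : G.edgeSet) : V := (D.exists_ends e).choose_spec.choose

lemma arc_source (e : G.edgeSet) : (D.arc e).source = D.vert (D.src e) :=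
  (D.exists_ends e).choose_spec.choose_spec.1

lemma arc_target (e : G.edgeSet) : (D.arc e).target = D.vert (D.tgt e) :=
  (D.exists_ends e).choose_spec.choose_spec.2.1

lemma edge_eq (e : G.edgeSet) : (e : Sym2 V) = s(D.src e, D.tgt e) :=
  (D.exists_ends e).choose_spec.choose_spec.2.2

lemma src_ne_tgt (e : G.edgeSet) : D.src e ≠ D.tgt e := by
  intro h
  apply (D.arc e).source_ne_target
  rw [D.arc_source, D.arc_target, h]

lemma mem_crossings {e f : G.edgeSet} (h : e ≠ f) {p : Plane} (he : p ∈ (D.arc e).inner)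
    (hf : p ∈ (D.arc f).inner) : p ∈ D.crossings := ⟨e, f, h, he, hf⟩

lemma exists_ne_of_mem_crossings {p : Plane} (hp : p ∈ D.crossings) (e : G.edgeSet) :
    ∃ f, f ≠ e ∧ p ∈ (D.arc f).inner := by
  obtain ⟨e', f', hne, he, hf⟩ := hp
  by_cases h : e' = e
  · exact ⟨f', fun h' => hne (h.trans h'.symm), hf⟩
  · exact ⟨e', h, he⟩

lemma crossing_unique {e : G.edgeSet} {p q : Plane} (hp : p ∈ D.crossings) (hq : q ∈ D.crossings)
    (hpe : p ∈ (D.arc e).inner) (hqe : q ∈ (D.arc e).inner) : p = q := by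
  obtain ⟨f, hf, hpf⟩ := D.exists_ne_of_mem_crossings hp e
  obtain ⟨g, hg, hqg⟩ := D.exists_ne_of_mem_crossings hq e
  exact (D.crossed_at_most_once e f g hf hg p ⟨hpe, hpf⟩ q ⟨hqe, hqg⟩).2

/-- The two edges through a crossing. -/
noncomputable def edgeAt (c : D.crossings) (b : Bool) : G.edgeSet :=
  if b then c.2.choose else c.2.choose_spec.choose

lemma mem_edgeAt (c : D.crossings) (b : Bool) : (c : Plane) ∈ (D.arc (D.edgeAt c b)).inner := by
  cases b
  · exact c.2.choose_spec.choose_spec.2.2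
  · exact c.2.choose_spec.choose_spec.2.1

lemma edgeAt_ne (c : D.crossings) : D.edgeAt c true ≠ D.edgeAt c false :=
  c.2.choose_spec.choose_spec.1

/-- A third edge through `c` would be crossed by two different edges. -/
lemma eq_edgeAt {c : D.crossings} {g : G.edgeSet} (hg : (c : Plane) ∈ (D.arc g).inner) :
    g = D.edgeAt c true ∨ g = D.edgeAt c false := by
  by_contra hcon
  push Not at hcon
  have := D.crossed_at_most_once g _ _ hcon.1.symm hcon.2.symm c ⟨hg, D.mem_edgeAt c true⟩ c
    ⟨hg, D.mem_edgeAt c false⟩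
  exact D.edgeAt_ne c this.1

lemma edgeAt_injective {c c' : D.crossings} {b b' : Bool} (h : D.edgeAt c b = D.edgeAt c' b') :
    c = c' ∧ b = b' := by
  have hc : c = c' := Subtype.ext
    (D.crossing_unique c.2 c'.2 (D.mem_edgeAt c b) (h ▸ D.mem_edgeAt c' b'))
  subst hc
  refine ⟨rfl, ?_⟩
  cases b <;> cases b' <;> first | rfl | exact absurd h (D.edgeAt_ne c) |
    exact absurd h.symm (D.edgeAt_ne c)

lemma finite_crossings [Finite V] : Finite D.crossings :=
  Finite.of_injective (fun c => D.edgeAt c true) fun _ _ h => (D.edgeAt_injective h).1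

/-- The edges that remain when one edge is deleted from each crossing. -/
def Kept : Type _ := {e : G.edgeSet // ∀ c, e ≠ D.edgeAt c true}

/-- The plane drawing that remains when one edge is deleted from each crossing. -/
noncomputable def keptSystem : PlaneArcSystem V D.Kept where
  vert := D.vert
  src e := D.src e.1
  tgt e := D.tgt e.1
  arc e := D.arc e.1
  vert_injective := D.vert_injective
  arc_source e := D.arc_source e.1
  arc_target e := D.arc_target e.1
  vert_notMem e v := D.vert_not_mem_inner e.1 v
  disjoint e f h := by
    have hne : e.1 ≠ f.1 := fun h' => h (Subtype.ext h')
    rw [Set.disjoint_left]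
    intro p he hf
    have hc := D.mem_crossings hne he hf
    have h1 := (D.eq_edgeAt (c := ⟨p, hc⟩) he).resolve_left (e.2 _)
    have h2 := (D.eq_edgeAt (c := ⟨p, hc⟩) hf).resolve_left (f.2 _)
    exact hne (h1.trans h2.symm)

/-- A simple graph of minimum degree two has at least three edges. -/
lemma three_le_card (T : Finset D.Kept) (hne : T.Nonempty)
    (hT : ∀ i ∈ T, ∀ v, D.keptSystem.Inc i v → ∃ j ∈ T, j ≠ i ∧ D.keptSystem.Inc j v) :
    3 ≤ T.card := by
  have hmem : ∀ (e : D.Kept) v, D.keptSystem.Inc e v ↔ v ∈ (e.1 : Sym2 V) := by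
    intro e v
    rw [D.edge_eq, Sym2.mem_iff]
    exact or_congr eq_comm eq_comm
  obtain ⟨e, he⟩ := hne
  obtain ⟨e₁, he₁, hne₁, h₁⟩ := hT e he (D.src e.1) (Or.inl rfl)
  obtain ⟨e₂, he₂, hne₂, h₂⟩ := hT e he (D.tgt e.1) (Or.inr rfl)
  have h12 : e₁ ≠ e₂ := by
    rintro rfl
    apply hne₁
    apply Subtype.ext
    apply Subtype.ext
    rw [D.edge_eq e.1]
    exact (Sym2.mem_and_mem_iff (D.src_ne_tgt e.1)).1 ⟨(hmem _ _).1 h₁, (hmem _ _).1 h₂⟩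
  exact Finset.two_lt_card_iff.2 ⟨e, e₁, e₂, he, he₁, he₂, hne₁.symm, hne₂.symm, h12⟩

/-- The kept edges form a plane simple graph, to which Euler's bound with `g = 3` applies; at most
one edge per crossing was deleted. The hypothesis `3 ≤ Nat.card V` covers the forest-like
alternative and the case of no kept edge. -/
theorem card_edges_add_six_le [Finite V] (hV : 3 ≤ Nat.card V) :
    Nat.card G.edgeSet + 6 ≤ 3 * Nat.card V + Nat.card D.crossings := by
  classical
  have := D.finite_crossings
  have := Fintype.ofFinite V
  have hfin : Finite D.Kept := inferInstanceAs (Finite {e : G.edgeSet // ∀ c, e ≠ D.edgeAt c true})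
  have := Fintype.ofFinite D.Kept
  have hm : Nat.card G.edgeSet ≤ Nat.card D.Kept + Nat.card D.crossings := by
    rw [← Nat.card_sum]
    refine Nat.card_le_card_of_surjective
      (Sum.elim (fun e : D.Kept => e.1) fun c => D.edgeAt c true) fun e => ?_
    by_cases h : ∀ c, e ≠ D.edgeAt c true
    · exact ⟨Sum.inl ⟨e, h⟩, rfl⟩
    · push Not at h
      obtain ⟨c, hc⟩ := h
      exact ⟨Sum.inr c, hc.symm⟩
  rcases isEmpty_or_nonempty D.Kept with hK | hK
  · rw [Nat.card_of_isEmpty (α := D.Kept)] at hm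
    omega
  · have := D.keptSystem.euler_bound 3 D.three_le_card
    rw [← Nat.card_eq_fintype_card, ← Nat.card_eq_fintype_card] at this
    omega

/-! ### Edges from vertices to crossings -/

/-- The ends of the two edges through a crossing. -/
noncomputable def endAt (c : D.crossings) (k : Bool × Bool) : V :=
  if k.2 then D.tgt (D.edgeAt c k.1) else D.src (D.edgeAt c k.1)

lemma endAt_mem (c : D.crossings) (k : Bool × Bool) :
    D.endAt c k ∈ (D.edgeAt c k.1 : Sym2 V) := by
  rw [D.edge_eq, endAt]
  split_ifs
  · exact Sym2.mem_mk_right _ _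
  · exact Sym2.mem_mk_left _ _

/-- Adjacent edges do not cross, so the two edges at a crossing have four distinct ends. -/
lemma endAt_injective (c : D.crossings) : Function.Injective (D.endAt c) := by
  rintro ⟨b, h⟩ ⟨b', h'⟩ heq
  have hb : b = b' := by
    by_contra hne
    have hee : D.edgeAt c b ≠ D.edgeAt c b' := fun h => hne (D.edgeAt_injective h).2
    exact Set.disjoint_left.1 (D.adjacent_not_cross _ _ hee
      ⟨D.endAt c (b, h), D.endAt_mem c (b, h), heq ▸ D.endAt_mem c (b', h')⟩)
      (D.mem_edgeAt c b) (D.mem_edgeAt c b')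
  subst hb
  have := D.src_ne_tgt (D.edgeAt c b)
  cases h <;> cases h' <;> first | rfl | exact absurd heq this | exact absurd heq.symm this

lemma endAt_mem_neighborSet (c : D.crossings) (k : Bool × Bool) :
    Sum.inl (D.endAt c k) ∈ D.associatedGraph.neighborSet (Sum.inr c) :=
  ⟨D.edgeAt c k.1, D.endAt_mem c k, D.mem_edgeAt c k.1⟩

lemma four_le_card [Finite V] (c : D.crossings) : 4 ≤ Nat.card V := by
  have := Nat.card_le_card_of_injective _ (D.endAt_injective c)
  simpa using this

/-- Each crossing owns four vertices, and no vertex is owned by two crossings. -/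
lemma four_mul_card_le [Finite V] (hD : D.CommonNeighborsLE 0) :
    4 * Nat.card D.crossings ≤ Nat.card V := by
  have h : Function.Injective fun x : D.crossings × (Bool × Bool) => D.endAt x.1 x.2 := by
    rintro ⟨c, k⟩ ⟨c', k'⟩ heq
    by_cases hcc : c = c'
    · subst hcc
      exact congrArg _ (D.endAt_injective c heq)
    · exfalso
      have h0 := hD c c' hcc
      simp only [Nat.cast_zero, nonpos_iff_eq_zero, encard_eq_zero] at h0
      have : Sum.inl (D.endAt c k) ∈ D.associatedGraph.neighborSet (Sum.inr c) ∩
          D.associatedGraph.neighborSet (Sum.inr c') :=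
        ⟨D.endAt_mem_neighborSet c k, by
          have : D.endAt c k = D.endAt c' k' := heq
          rw [this]; exact D.endAt_mem_neighborSet c' k'⟩
      rw [h0] at this
      exact this
  have := Nat.card_le_card_of_injective _ h
  rw [Nat.card_prod, Nat.card_prod] at this
  simp only [Nat.card_eq_fintype_card, Fintype.card_bool] at this ⊢
  omega

/-- One of the two parts into which a crossing cuts an edge. -/
noncomputable def halfArc (x : D.crossings × (Bool × Bool)) : PolygonalArc :=
  if x.2.2 then ((D.arc (D.edgeAt x.1 x.2.1)).exists_split (D.mem_edgeAt x.1 x.2.1)).choose_spec.choose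
  else ((D.arc (D.edgeAt x.1 x.2.1)).exists_split (D.mem_edgeAt x.1 x.2.1)).choose

lemma halfArc_spec (c : D.crossings) (b : Bool) :
    (D.halfArc (c, b, false)).source = (D.arc (D.edgeAt c b)).source ∧
    (D.halfArc (c, b, false)).target = c ∧ (D.halfArc (c, b, true)).source = c ∧
    (D.halfArc (c, b, true)).target = (D.arc (D.edgeAt c b)).target ∧
    (D.halfArc (c, b, false)).inner ⊆ (D.arc (D.edgeAt c b)).inner \ {(c : Plane)} ∧
    (D.halfArc (c, b, true)).inner ⊆ (D.arc (D.edgeAt c b)).inner \ {(c : Plane)} ∧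
    Disjoint (D.halfArc (c, b, false)).inner (D.halfArc (c, b, true)).inner :=
  ((D.arc (D.edgeAt c b)).exists_split (D.mem_edgeAt c b)).choose_spec.choose_spec

lemma halfArc_inner_subset (x : D.crossings × (Bool × Bool)) :
    (D.halfArc x).inner ⊆ (D.arc (D.edgeAt x.1 x.2.1)).inner \ {(x.1 : Plane)} := by
  obtain ⟨c, b, h⟩ := x
  cases h
  · exact (D.halfArc_spec c b).2.2.2.2.1
  · exact (D.halfArc_spec c b).2.2.2.2.2.1

/-- The bipartite plane graph of vertices and crossings. -/
noncomputable def crossingSystem :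
    PlaneArcSystem (V ⊕ D.crossings) (D.crossings × (Bool × Bool)) where
  vert := Sum.elim D.vert Subtype.val
  src x := if x.2.2 then Sum.inr x.1 else Sum.inl (D.src (D.edgeAt x.1 x.2.1))
  tgt x := if x.2.2 then Sum.inl (D.tgt (D.edgeAt x.1 x.2.1)) else Sum.inr x.1
  arc := D.halfArc
  vert_injective := D.vert_injective.sumElim Subtype.val_injective fun v c h =>
    D.vert_not_mem_inner _ v (h ▸ D.mem_edgeAt c true)
  arc_source := by
    rintro ⟨c, b, h⟩
    cases h
    · exact (D.halfArc_spec c b).1.trans (D.arc_source _)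
    · exact (D.halfArc_spec c b).2.2.1
  arc_target := by
    rintro ⟨c, b, h⟩
    cases h
    · exact (D.halfArc_spec c b).2.1
    · exact (D.halfArc_spec c b).2.2.2.1.trans (D.arc_target _)
  vert_notMem x v h := by
    have hx := D.halfArc_inner_subset x h
    rcases v with v | c
    · exact D.vert_not_mem_inner _ v hx.1
    · exact hx.2 (D.crossing_unique c.2 x.1.2 hx.1 (D.mem_edgeAt x.1 x.2.1))
  disjoint := by
    rintro ⟨c, b, h⟩ ⟨c', b', h'⟩ hne
    by_cases he : D.edgeAt c b = D.edgeAt c' b'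
    · obtain ⟨rfl, rfl⟩ := D.edgeAt_injective he
      have hd := (D.halfArc_spec c b).2.2.2.2.2.2
      cases h <;> cases h' <;> first | exact absurd rfl hne | exact hd | exact hd.symm
    · rw [Set.disjoint_left]
      intro p hp hp'
      have h1 := D.halfArc_inner_subset _ hp
      have h2 := D.halfArc_inner_subset _ hp'
      exact h1.2 (D.crossing_unique (D.mem_crossings he h1.1 h2.1) c.2 h1.1 (D.mem_edgeAt c b))

lemma crossingSystem_inc_inl {x : D.crossings × (Bool × Bool)} {v : V} :
    D.crossingSystem.Inc x (Sum.inl v) ↔ D.endAt x.1 x.2 = v := by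
  obtain ⟨c, b, h⟩ := x
  cases h <;> simp [PlaneArcSystem.Inc, crossingSystem, endAt]

lemma crossingSystem_inc_inr {x : D.crossings × (Bool × Bool)} {c : D.crossings} :
    D.crossingSystem.Inc x (Sum.inr c) ↔ x.1 = c := by
  obtain ⟨c, b, h⟩ := x
  cases h <;> simp [PlaneArcSystem.Inc, crossingSystem]

lemma eq_of_endAt_eq (hD : D.CommonNeighborsLE 1) {c c' : D.crossings} (hcc : c ≠ c')
    {k l k' l' : Bool × Bool} (h1 : D.endAt c k = D.endAt c' k')
    (h2 : D.endAt c l = D.endAt c' l') : D.endAt c k = D.endAt c l := by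
  have h := hD c c' hcc
  rw [Nat.cast_one, encard_le_one_iff] at h
  refine Sum.inl_injective (h (Sum.inl (D.endAt c k)) (Sum.inl (D.endAt c l))
    ⟨D.endAt_mem_neighborSet c k, ?_⟩ ⟨D.endAt_mem_neighborSet c l, ?_⟩)
  · rw [h1]; exact D.endAt_mem_neighborSet c' k'
  · rw [h2]; exact D.endAt_mem_neighborSet c' l'

/-- Vertices of degree one are excluded, so one can walk from a crossing through a vertex to a
second crossing and through another vertex to a third. The third differs from the first, since
otherwise two crossings would share two neighbours. Each of the three crossings carries two edges of
`T`. -/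
lemma six_le_card (hD : D.CommonNeighborsLE 1) (T : Finset (D.crossings × (Bool × Bool)))
    (hne : T.Nonempty) (hT : ∀ i ∈ T, ∀ v, D.crossingSystem.Inc i v →
      ∃ j ∈ T, j ≠ i ∧ D.crossingSystem.Inc j v) : 6 ≤ T.card := by
  classical
  have hv : ∀ x ∈ T, ∃ y ∈ T, y.1 ≠ x.1 ∧ D.endAt y.1 y.2 = D.endAt x.1 x.2 := by
    intro x hx
    obtain ⟨y, hy, hyx, h⟩ := hT x hx _ (D.crossingSystem_inc_inl.2 rfl)
    have h' := D.crossingSystem_inc_inl.1 h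
    refine ⟨y, hy, fun hc => hyx ?_, h'⟩
    obtain ⟨c, k⟩ := x
    obtain ⟨c', k'⟩ := y
    obtain rfl : c' = c := hc
    exact congrArg _ (D.endAt_injective c' h')
  have hc : ∀ x ∈ T, ∃ y ∈ T, y ≠ x ∧ y.1 = x.1 := by
    intro x hx
    obtain ⟨y, hy, hyx, h⟩ := hT x hx _ (D.crossingSystem_inc_inr.2 rfl)
    exact ⟨y, hy, hyx, D.crossingSystem_inc_inr.1 h⟩
  obtain ⟨d₁, hd₁⟩ := hne
  obtain ⟨d₂, hd₂, h21, hv21⟩ := hv d₁ hd₁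
  obtain ⟨d₃, hd₃, h32, hc32⟩ := hc d₂ hd₂
  obtain ⟨d₄, hd₄, h43, hv43⟩ := hv d₃ hd₃
  obtain ⟨d₅, hd₅, h51, hc51⟩ := hc d₁ hd₁
  obtain ⟨d₆, hd₆, h64, hc64⟩ := hc d₄ hd₄
  -- If the walk returned to the first crossing, the ends of `d₂` and `d₃` would be common
  -- neighbours of two crossings, hence equal, forcing `d₂ = d₃`.
  have h41 : d₄.1 ≠ d₁.1 := by
    intro h
    rw [h] at hv43
    rw [hc32] at hv43
    have := D.eq_of_endAt_eq hD h21 hv21 hv43.symm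
    have h23 := D.endAt_injective _ this
    exact h32 (Prod.ext hc32 h23.symm)
  have hcard : ({d₁, d₅, d₂, d₃, d₄, d₆} : Finset (D.crossings × (Bool × Bool))).card = 6 := by
    have e1 : d₁ ≠ d₂ := fun h => h21 (h ▸ rfl)
    have e2 : d₁ ≠ d₃ := fun h => h21 (h ▸ hc32.symm)
    have e3 : d₁ ≠ d₄ := fun h => h41 (h ▸ rfl)
    have e4 : d₁ ≠ d₆ := fun h => h41 (by rw [← hc64, ← h])
    have e5 : d₅ ≠ d₂ := fun h => h21 (by rw [← hc51, ← h])
    have e6 : d₅ ≠ d₃ := fun h => h21 (by rw [← hc51, ← hc32, ← h])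
    have e7 : d₅ ≠ d₄ := fun h => h41 (by rw [← hc51, ← h])
    have e8 : d₅ ≠ d₆ := fun h => h41 (by rw [← hc51, ← hc64, ← h])
    have e9 : d₂ ≠ d₄ := fun h => h43 (by rw [hc32, ← h])
    have e10 : d₂ ≠ d₆ := fun h => h43 (by rw [← hc64, ← h, hc32])
    have e11 : d₃ ≠ d₄ := fun h => h43 (by rw [← h])
    have e12 : d₃ ≠ d₆ := fun h => h43 (by rw [← hc64, ← h])
    rw [Finset.card_insert_of_notMem (by simp [h51.symm, e1, e2, e3, e4]),
      Finset.card_insert_of_notMem (by simp [e5, e6, e7, e8]),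
      Finset.card_insert_of_notMem (by simp [h32.symm, e9, e10]),
      Finset.card_insert_of_notMem (by simp [e11, e12]), Finset.card_pair h64.symm]
  rw [← hcard]
  refine Finset.card_le_card fun d hd => ?_
  simp only [Finset.mem_insert, Finset.mem_singleton] at hd
  rcases hd with rfl | rfl | rfl | rfl | rfl | rfl <;> assumption

/-- Euler's bound with `g = 6`, `4c` edges and `N + c` vertices reads `6(4c + 2) ≤ 8c + 6(N + c)`.
The forest-like alternative `4c + 1 ≤ N + c` is even stronger once `N ≥ 4`. -/
theorem five_mul_card_add_six_le [Finite V] (hV : 4 ≤ Nat.card V) (hD : D.CommonNeighborsLE 1) :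
    5 * Nat.card D.crossings + 6 ≤ 3 * Nat.card V := by
  classical
  have := D.finite_crossings
  have := Fintype.ofFinite V
  have := Fintype.ofFinite D.crossings
  rcases isEmpty_or_nonempty D.crossings with hK | hK
  · rw [Nat.card_of_isEmpty]
    omega
  · have h := D.crossingSystem.euler_bound 6 (D.six_le_card hD)
    rw [Fintype.card_prod, Fintype.card_prod, Fintype.card_bool, Fintype.card_sum,
      ← Nat.card_eq_fintype_card, ← Nat.card_eq_fintype_card] at h
    omega

end OnePlanarDrawing

/-! ### The upper bound for joins and the criterion for not being in `𝒞₀`. -/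

lemma card_join_edgeSet {V : Type*} [Finite V] (G : SimpleGraph V) :
    Nat.card G.edgeSet + Nat.card V ≤ Nat.card (join G (SimpleGraph.pathGraph 1)).edgeSet := by
  rw [← Nat.card_sum]
  let F : G.edgeSet ⊕ V → Sym2 (V ⊕ Fin 1) :=
    Sum.elim (fun e => Sym2.map Sum.inl e.1) fun v => s(Sum.inl v, Sum.inr 0)
  have hF : ∀ x, F x ∈ (join G (SimpleGraph.pathGraph 1)).edgeSet := by
    rintro (⟨e, he⟩ | v)
    · induction e using Sym2.ind with
      | _ a b => exact Or.inl he
    · exact Or.inr (Or.inl ⟨rfl, rfl⟩)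
  have hkey : ∀ (e : G.edgeSet) v, Sym2.map (Sum.inl : V → V ⊕ Fin 1) e.1 ≠
      s(Sum.inl v, Sum.inr 0) := by
    intro e v h
    have : (Sum.inr 0 : V ⊕ Fin 1) ∈ Sym2.map Sum.inl e.1 := h ▸ Sym2.mem_mk_right _ _
    obtain ⟨a, -, ha⟩ := Sym2.mem_map.1 this
    exact Sum.inl_ne_inr ha
  refine Nat.card_le_card_of_injective (fun x => ⟨F x, hF x⟩) fun x y h => ?_
  have h : F x = F y := congrArg Subtype.val h
  rcases x with e | v <;> rcases y with e' | v'
  · exact congrArg _ (Subtype.ext (Sym2.map.injective Sum.inl_injective h))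
  · exact absurd h (hkey e v')
  · exact absurd h.symm (hkey e' v)
  · have : v = v' := by
      have h' : s((Sum.inl v : V ⊕ Fin 1), Sum.inr 0) = s(Sum.inl v', Sum.inr 0) := h
      simpa using h'
    rw [this]

theorem card_edges_le_of_isClassC1 {V : Type*} [Finite V] (G : SimpleGraph V)
    (h : IsClassC1 (join G (SimpleGraph.pathGraph 1))) :
    5 * Nat.card G.edgeSet + 18 ≤ 13 * Nat.card V := by
  obtain ⟨h0, D, hD⟩ := h
  obtain ⟨c⟩ : Nonempty D.crossings := by
    by_contra hcon
    rw [not_nonempty_iff] at hcon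
    exact h0 ⟨D, fun c => (hcon.false c).elim⟩
  have h1 := D.four_le_card c
  have h2 := D.card_edges_add_six_le (by omega)
  have h3 := D.five_mul_card_add_six_le h1 hD
  have h4 := card_join_edgeSet G
  have h5 : Nat.card (V ⊕ Fin 1) = Nat.card V + 1 := by
    rw [Nat.card_sum, Nat.card_fin]
  omega

/-- Combining `E + 6 ≤ 3N + c` with `4c ≤ N` gives `4E + 24 ≤ 13N`. -/
theorem not_isClassC0 {V : Type*} [Finite V] (G : SimpleGraph V) (hV : 3 ≤ Nat.card V)
    (h : 13 * Nat.card V < 4 * Nat.card G.edgeSet + 24) : ¬ IsClassC0 G := by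
  rintro ⟨D, hD⟩
  have h1 := D.card_edges_add_six_le hV
  have h2 := D.four_mul_card_le hD
  omega

/-! ### Straight arcs -/

/-- A segment as a polygonal arc. -/
def segmentArc (p q : Plane) (h : p ≠ q) : PolygonalArc where
  len := 1
  len_pos := Nat.one_pos
  pt n := if n = 0 then p else q
  pt_ne i hi := by
    obtain rfl : i = 0 := by omega
    simpa using h
  consecutive i hi := by omega
  far i j h h' := by omega

lemma segmentArc_carrier (p q : Plane) (h : p ≠ q) :
    (segmentArc p q h).carrier = segment ℝ p q := by
  ext x
  rw [PolygonalArc.mem_carrier]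
  simp [segmentArc]

lemma segmentArc_inner (p q : Plane) (h : p ≠ q) :
    (segmentArc p q h).inner = openSegment ℝ p q := by
  have e : (segmentArc p q h).inner = segment ℝ p q \ {p, q} := by
    rw [PolygonalArc.inner, segmentArc_carrier]; rfl
  rw [e, ← insert_endpoints_openSegment]
  ext x
  constructor
  · rintro ⟨h1 | h1 | h1, h2⟩
    · exact absurd (Or.inl h1) h2
    · exact absurd (Or.inr h1) h2
    · exact h1
  · intro hx
    refine ⟨Or.inr (Or.inr hx), ?_⟩
    rintro (rfl | rfl)
    · exact h (left_mem_openSegment_iff.1 hx)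
    · exact h (right_mem_openSegment_iff.1 hx)

/-! ### Chords of a parabola -/

/-- The point of the parabola with abscissa `a`. -/
def para (a : ℝ) : Plane := (a, a ^ 2)

lemma mem_openSegment_para {a b : ℝ} (h : a < b) {p : Plane} :
    p ∈ openSegment ℝ (para a) (para b) ↔ a < p.1 ∧ p.1 < b ∧ p.2 = (a + b) * p.1 - a * b := by
  have hba : 0 < b - a := sub_pos.2 h
  constructor
  · rintro ⟨s, t, hs, ht, hst, rfl⟩
    obtain rfl : s = 1 - t := by linarith
    simp only [para, Prod.smul_mk, Prod.mk_add_mk, smul_eq_mul]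
    refine ⟨by nlinarith [mul_pos ht hba], by nlinarith [mul_pos hs hba], by ring⟩
  · rintro ⟨h1, h2, h3⟩
    refine ⟨(b - p.1) / (b - a), (p.1 - a) / (b - a), div_pos (by linarith) hba,
      div_pos (by linarith) hba, by field_simp; ring, ?_⟩
    simp only [para, Prod.smul_mk, Prod.mk_add_mk, smul_eq_mul]
    refine Prod.ext ?_ ?_
    · simp only; field_simp; ring
    · simp only; rw [h3]; field_simp; ring

lemma sq_lt_of_mem_openSegment_para {a b : ℝ} (h : a < b) {p : Plane}
    (hp : p ∈ openSegment ℝ (para a) (para b)) : p.1 ^ 2 < p.2 := by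
  obtain ⟨h1, h2, h3⟩ := (mem_openSegment_para h).1 hp
  nlinarith [mul_pos (sub_pos.2 h1) (sub_pos.2 h2)]

/-- Only interleaved chords of a parabola cross. -/
lemma interleaved_of_mem {a b c d : ℝ} (hab : a < b) (hcd : c < d) {p : Plane}
    (h1 : p ∈ openSegment ℝ (para a) (para b)) (h2 : p ∈ openSegment ℝ (para c) (para d))
    (hne : ¬ (a = c ∧ b = d)) : a < c ∧ c < b ∧ b < d ∨ c < a ∧ a < d ∧ d < b := by
  obtain ⟨ha, hb, he⟩ := (mem_openSegment_para hab).1 h1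
  obtain ⟨hc, hd, he'⟩ := (mem_openSegment_para hcd).1 h2
  -- Both products equal `p.2 - p.1 ^ 2`, the height of `p` above the parabola.
  have key : (p.1 - a) * (b - p.1) = (p.1 - c) * (d - p.1) := by nlinarith
  have pa := sub_pos.2 ha
  have pb := sub_pos.2 hb
  have pc := sub_pos.2 hc
  have pd := sub_pos.2 hd
  rcases lt_trichotomy a c with hac | rfl | hac
  · left
    refine ⟨hac, by linarith, ?_⟩
    by_contra hbd
    push Not at hbd
    nlinarith [mul_lt_mul_of_pos_right (show p.1 - c < p.1 - a by linarith) pd,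
      mul_le_mul_of_nonneg_left (show d - p.1 ≤ b - p.1 by linarith) pa.le]
  · exact absurd ⟨rfl, by have := mul_left_cancel₀ pa.ne' key; linarith⟩ hne
  · right
    refine ⟨hac, by linarith, ?_⟩
    by_contra hbd
    push Not at hbd
    nlinarith [mul_lt_mul_of_pos_right (show p.1 - a < p.1 - c by linarith) pb,
      mul_le_mul_of_nonneg_left (show b - p.1 ≤ d - p.1 by linarith) pc.le]

lemma eq_of_mem_para {a b c d : ℝ} (hab : a < b) (hcd : c < d) (hne : a + b ≠ c + d) {p q : Plane}
    (h1 : p ∈ openSegment ℝ (para a) (para b)) (h2 : p ∈ openSegment ℝ (para c) (para d))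
    (h3 : q ∈ openSegment ℝ (para a) (para b)) (h4 : q ∈ openSegment ℝ (para c) (para d)) :
    p = q := by
  obtain ⟨-, -, e1⟩ := (mem_openSegment_para hab).1 h1
  obtain ⟨-, -, e2⟩ := (mem_openSegment_para hcd).1 h2
  obtain ⟨-, -, e3⟩ := (mem_openSegment_para hab).1 h3
  obtain ⟨-, -, e4⟩ := (mem_openSegment_para hcd).1 h4
  have h : (a + b - (c + d)) * (p.1 - q.1) = 0 := by linear_combination e2 - e1 + e3 - e4
  have h0 : p.1 = q.1 := sub_eq_zero.1 ((mul_eq_zero.1 h).resolve_left (sub_ne_zero.2 hne))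
  exact Prod.ext h0 (by rw [e1, e3, h0])

/-- The affine function `l` vanishing on the line of the first chord has opposite signs at two
points of the second chord on either side of `p`, because the slopes `a + b` and `c + d` differ. A
path between them has a zero of `l`, and close to `p` such a zero lies on the first chord itself. -/
lemma passesThrough_para {a b c d : ℝ} (hab : a < b) (hcd : c < d) (hne : a + b ≠ c + d)
    {p : Plane} (h1 : p ∈ openSegment ℝ (para a) (para b))
    (h2 : p ∈ openSegment ℝ (para c) (para d)) :
    PassesThrough (segment ℝ (para a) (para b)) (segment ℝ (para c) (para d)) p := by
  obtain ⟨ha, hb, e1⟩ := (mem_openSegment_para hab).1 h1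
  obtain ⟨hc, hd, e2⟩ := (mem_openSegment_para hcd).1 h2
  let l : Plane → ℝ := fun q => q.2 - ((a + b) * q.1 - a * b)
  have hl : Continuous l := by fun_prop
  have hlA : ∀ q ∈ segment ℝ (para a) (para b), l q = 0 := by
    rintro _ ⟨s, t, -, -, hst, rfl⟩
    obtain rfl : s = 1 - t := by linarith
    simp only [l, para, Prod.smul_mk, Prod.mk_add_mk, smul_eq_mul]
    ring
  set r := min (min (p.1 - a) (b - p.1)) (min (p.1 - c) (d - p.1)) with hr
  have hr0 : 0 < r := by simp only [hr, lt_min_iff, sub_pos]; exact ⟨⟨ha, hb⟩, hc, hd⟩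
  filter_upwards [Ioo_mem_nhdsGT hr0] with ε ⟨hε0, hεr⟩
  simp only [hr, lt_min_iff] at hεr
  obtain ⟨⟨r1, r2⟩, r3, r4⟩ := hεr
  -- A horizontal step `h` along the second chord moves both coordinates by at most `|h| * K`.
  set K := 1 + |c + d| with hK
  have hK1 : 1 ≤ K := by simp [hK]
  have hmem : ∀ h : ℝ, |h| * K < ε → h ≠ 0 →
      (p.1 + h, (c + d) * (p.1 + h) - c * d) ∈
        (segment ℝ (para c) (para d) ∩ Metric.ball p ε) \ segment ℝ (para a) (para b) ∧
      l (p.1 + h, (c + d) * (p.1 + h) - c * d) = (c + d - (a + b)) * h := by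
    intro h hh h0
    have hlv : l (p.1 + h, (c + d) * (p.1 + h) - c * d) = (c + d - (a + b)) * h := by
      simp only [l]; linear_combination e1 - e2
    have hhε : |h| < ε := lt_of_le_of_lt (le_mul_of_one_le_right (abs_nonneg h) hK1) hh
    obtain ⟨l1, l2⟩ := abs_lt.1 hhε
    refine ⟨⟨⟨openSegment_subset_segment ℝ _ _ ((mem_openSegment_para hcd).2
      ⟨by simp only; linarith, by simp only; linarith, rfl⟩), ?_⟩, ?_⟩, hlv⟩
    · rw [Metric.mem_ball, Prod.dist_eq, max_lt_iff, Real.dist_eq, Real.dist_eq]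
      refine ⟨by simpa using hhε, ?_⟩
      have : (c + d) * (p.1 + h) - c * d - p.2 = (c + d) * h := by rw [e2]; ring
      rw [this, abs_mul]
      calc |c + d| * |h| ≤ K * |h| := by
            apply mul_le_mul_of_nonneg_right _ (abs_nonneg h); simp [hK]
        _ < ε := by rwa [mul_comm]
    · intro hA
      have := hlA _ hA
      rw [hlv] at this
      exact (mul_ne_zero (sub_ne_zero.2 hne.symm) h0) this
  set h := ε / (2 * K) with hh
  have hh0 : 0 < h := by positivity
  have hhK : |h| * K < ε := by
    rw [abs_of_pos hh0, hh]; field_simp; linarith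
  obtain ⟨hx, hlx⟩ := hmem h hhK hh0.ne'
  obtain ⟨hy, hly⟩ := hmem (-h) (by rwa [abs_neg]) (neg_ne_zero.2 hh0.ne')
  refine ⟨_, hx, _, hy, ?_⟩
  rintro ⟨γ, hγ⟩
  have hcont : Continuous fun t => l (γ t) := hl.comp γ.continuous
  have h0 : (0 : ℝ) ∈ range fun t => l (γ t) := by
    rcases lt_or_gt_of_ne (sub_ne_zero.2 hne) with hs | hs
    · refine mem_range_of_exists_le_of_exists_ge hcont ⟨1, ?_⟩ ⟨0, ?_⟩
      · rw [γ.target, hly]; nlinarith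
      · rw [γ.source, hlx]; nlinarith
    · refine mem_range_of_exists_le_of_exists_ge hcont ⟨0, ?_⟩ ⟨1, ?_⟩
      · rw [γ.source, hlx]; nlinarith
      · rw [γ.target, hly]; nlinarith
  obtain ⟨t, ht⟩ := h0
  obtain ⟨hball, hnA⟩ := hγ t
  apply hnA
  rw [Metric.mem_ball, Prod.dist_eq, max_lt_iff, Real.dist_eq] at hball
  obtain ⟨l1, l2⟩ := abs_lt.1 hball.1
  refine openSegment_subset_segment ℝ _ _ ((mem_openSegment_para hab).2
    ⟨by linarith, by linarith, ?_⟩)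
  have ht : (γ t).2 - ((a + b) * (γ t).1 - a * b) = 0 := ht
  linarith

/-! ### Segments to a point far below the parabola -/

lemma mem_openSegment_apex {a M : ℝ} {p : Plane} (hp : p ∈ openSegment ℝ (para a) (0, -M)) :
    ∃ t, 0 < t ∧ t < 1 ∧ p.1 = t * a ∧ p.2 = t * (a ^ 2 + M) - M := by
  obtain ⟨s, t, hs, ht, hst, rfl⟩ := hp
  obtain rfl : t = 1 - s := by linarith
  refine ⟨s, hs, by linarith, ?_, ?_⟩
  · simp [para]
  · simp only [para, Prod.smul_mk, Prod.mk_add_mk, smul_eq_mul]; ring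

lemma lt_sq_of_mem_openSegment_apex {a M : ℝ} (hM : a ^ 2 < M) {p : Plane}
    (hp : p ∈ openSegment ℝ (para a) (0, -M)) : p.2 < p.1 ^ 2 ∧ -M < p.2 := by
  obtain ⟨t, h0, h1, e1, e2⟩ := mem_openSegment_apex hp
  rw [e1, e2]
  have h2 : 0 < 1 - t := by linarith
  have h3 : 0 < M - t * a ^ 2 := by nlinarith [sq_nonneg a]
  refine ⟨by nlinarith [mul_pos h2 h3], ?_⟩
  have : 0 < a ^ 2 + M := by nlinarith [sq_nonneg a]
  nlinarith [mul_pos h0 this]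

/-- Points of the parabola with distinct abscissas `a`, `b` are collinear with `(0, -M)` only if `a
* b = M`. -/
lemma eq_of_mem_apex {a b M : ℝ} (hM : a * b < M) {p : Plane}
    (ha : p ∈ openSegment ℝ (para a) (0, -M)) (hb : p ∈ openSegment ℝ (para b) (0, -M)) :
    a = b := by
  obtain ⟨t, h0, h1, e1, e2⟩ := mem_openSegment_apex ha
  obtain ⟨s, h0', h1', e1', e2'⟩ := mem_openSegment_apex hb
  have k1 : t * a = s * b := by rw [← e1, e1']
  have k2 : t * (a ^ 2 + M) = s * (b ^ 2 + M) := by linarith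
  have k3 : t * ((a - b) * (a * b - M)) = 0 := by
    linear_combination b * k2 - (b ^ 2 + M) * k1
  rcases mul_eq_zero.1 k3 with h | h
  · exact absurd h h0.ne'
  · rcases mul_eq_zero.1 h with h | h
    · linarith
    · linarith

/-! ### The extremal graphs -/

/-- Adjacency of `a < b`: a path and the chords cutting the polygon on this path into
quadrilaterals with both diagonals and triangles. -/
def ChordRel (a b : ℕ) : Prop :=
  b = a + 1 ∨ a = 0 ∧ 0 < b ∧ (b % 5 = 0 ∨ b % 5 = 1 ∨ b % 5 = 4) ∨
    a % 5 = 1 ∧ (b = a + 2 ∨ b = a + 3) ∨ (a % 5 = 2 ∨ a % 5 = 4) ∧ b = a + 2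

instance : DecidableRel ChordRel := fun a b => by unfold ChordRel; infer_instance

lemma ChordRel.lt {a b : ℕ} (h : ChordRel a b) : a < b := by
  unfold ChordRel at h; omega

/-- The graph `G_k`. -/
def chordGraph (k : ℕ) : SimpleGraph (Fin (5 * k + 2)) where
  Adj a b := ChordRel a b ∨ ChordRel b a
  symm := ⟨fun _ _ h => h.symm⟩
  loopless := ⟨fun a h => by rcases h with h | h <;> exact lt_irrefl _ h.lt⟩

/-- The smaller neighbours of a vertex. -/
def lowerNeighbors (b : ℕ) : Finset ℕ := (Finset.range b).filter fun a => ChordRel a b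

lemma sum_card_lowerNeighbors (k : ℕ) :
    ∑ b ∈ Finset.range (5 * k + 2), (lowerNeighbors b).card = 12 * k + 1 := by
  induction k with
  | zero => decide
  | succ k ih =>
    have h : ∀ b (s : Finset ℕ), (∀ a, a ∈ s ↔ a < b ∧ ChordRel a b) → lowerNeighbors b = s := by
      intro b s hs
      ext a
      rw [lowerNeighbors, Finset.mem_filter, Finset.mem_range, hs]
    -- Each block of five new vertices brings `1 + 2 + 4 + 2 + 3 = 12` edges.
    have h2 : lowerNeighbors (5 * k + 2) = {5 * k + 1} := h _ _ fun a => by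
      simp only [Finset.mem_singleton, ChordRel]; omega
    have h3 : lowerNeighbors (5 * k + 3) = {5 * k + 2, 5 * k + 1} := h _ _ fun a => by
      simp only [Finset.mem_insert, Finset.mem_singleton, ChordRel]; omega
    have h4 : lowerNeighbors (5 * k + 4) = {5 * k + 3, 5 * k + 2, 5 * k + 1, 0} := h _ _ fun a => by
      simp only [Finset.mem_insert, Finset.mem_singleton, ChordRel]; omega
    have h5 : lowerNeighbors (5 * k + 5) = {5 * k + 4, 0} := h _ _ fun a => by
      simp only [Finset.mem_insert, Finset.mem_singleton, ChordRel]; omega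
    have h6 : lowerNeighbors (5 * k + 6) = {5 * k + 5, 5 * k + 4, 0} := h _ _ fun a => by
      simp only [Finset.mem_insert, Finset.mem_singleton, ChordRel]; omega
    have e : 5 * (k + 1) + 2 = 5 * k + 2 + 1 + 1 + 1 + 1 + 1 := by ring
    rw [e, Finset.sum_range_succ, Finset.sum_range_succ, Finset.sum_range_succ,
      Finset.sum_range_succ, Finset.sum_range_succ, ih, h2, h3, h4, h5, h6]
    rw [Finset.card_singleton, Finset.card_pair (by omega), Finset.card_pair (by omega),
      Finset.card_insert_of_notMem (by simp), Finset.card_insert_of_notMem (by simp),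
      Finset.card_pair (by omega), Finset.card_insert_of_notMem (by simp),
      Finset.card_pair (by omega)]
    ring

lemma ncard_chordGraph (k : ℕ) : (chordGraph k).edgeSet.ncard = 12 * k + 1 := by
  set S : Finset (Σ _ : ℕ, ℕ) := (Finset.range (5 * k + 2)).sigma lowerNeighbors with hS
  let f : (Σ _ : ℕ, ℕ) → Sym2 (Fin (5 * k + 2)) := fun x =>
    s(Fin.ofNat (5 * k + 2) x.2, Fin.ofNat (5 * k + 2) x.1)
  have hval : ∀ x ∈ S, ((Fin.ofNat (5 * k + 2) x.2 : Fin (5 * k + 2)) : ℕ) = x.2 ∧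
      ((Fin.ofNat (5 * k + 2) x.1 : Fin (5 * k + 2)) : ℕ) = x.1 ∧ ChordRel x.2 x.1 := by
    intro x hx
    rw [hS, Finset.mem_sigma, lowerNeighbors, Finset.mem_filter, Finset.mem_range,
      Finset.mem_range] at hx
    exact ⟨Nat.mod_eq_of_lt (by omega), Nat.mod_eq_of_lt hx.1, hx.2.2⟩
  have himg : (chordGraph k).edgeSet = f '' S := by
    ext e
    constructor
    · intro he
      have key : ∀ a b : Fin (5 * k + 2), ChordRel a b → s(a, b) ∈ f '' S := by
        intro a b hab
        refine ⟨⟨b, a⟩, ?_, ?_⟩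
        · rw [Finset.mem_coe, hS, Finset.mem_sigma, lowerNeighbors, Finset.mem_filter,
            Finset.mem_range, Finset.mem_range]
          exact ⟨b.2, hab.lt, hab⟩
        · simp [f]
      induction e using Sym2.ind with
      | _ a b =>
        rcases he with h | h
        · exact key a b h
        · rw [Sym2.eq_swap]; exact key b a h
    · rintro ⟨x, hx, rfl⟩
      obtain ⟨h1, h2, h3⟩ := hval x hx
      refine Or.inl ?_
      rw [h1, h2]
      exact h3
  have hinj : Set.InjOn f S := by
    rintro x hx y hy hxy
    obtain ⟨h1, h2, h3⟩ := hval x hx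
    obtain ⟨h1', h2', h3'⟩ := hval y hy
    have := h3.lt
    have := h3'.lt
    rw [Sym2.eq_iff, Fin.ext_iff, Fin.ext_iff, Fin.ext_iff, Fin.ext_iff, h1, h2, h1', h2'] at hxy
    obtain ⟨x1, x2⟩ := x
    obtain ⟨y1, y2⟩ := y
    simp only at *
    obtain ⟨rfl, rfl⟩ : x1 = y1 ∧ x2 = y2 := by omega
    rfl
  rw [himg, hinj.ncard_image, Set.ncard_coe_finset, hS, Finset.card_sigma,
    sum_card_lowerNeighbors]

/-- `a < c < b < d` are the corners of a quadrilateral with diagonals `ab` and `cd`. -/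
def Quad (a c b d : ℕ) : Prop :=
  a % 5 = 1 ∧ c = a + 1 ∧ b = a + 2 ∧ d = a + 3 ∨ a = 0 ∧ c % 5 = 4 ∧ b = c + 1 ∧ d = c + 2

lemma quad_of_interleaved {a b c d : ℕ} (hab : ChordRel a b) (hcd : ChordRel c d) (h1 : a < c)
    (h2 : c < b) (h3 : b < d) : Quad a c b d := by
  unfold ChordRel at *
  unfold Quad
  omega

/-- Quadrilaterals of the first kind occupy disjoint blocks of four consecutive vertices, those of
the second kind meet pairwise only in `0`, and one of each kind meet in at most one end of a block.
-/
lemma Quad.eq_of_common {a c b d a' c' b' d' u v : ℕ} (h : Quad a c b d) (h' : Quad a' c' b' d')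
    (hu : u = a ∨ u = c ∨ u = b ∨ u = d) (hu' : u = a' ∨ u = c' ∨ u = b' ∨ u = d')
    (hv : v = a ∨ v = c ∨ v = b ∨ v = d) (hv' : v = a' ∨ v = c' ∨ v = b' ∨ v = d')
    (huv : u ≠ v) : a = a' ∧ c = c' ∧ b = b' ∧ d = d' := by
  have key : ∀ {a c b d u : ℕ}, Quad a c b d → (u = a ∨ u = c ∨ u = b ∨ u = d) →
      (a % 5 = 1 ∧ c = a + 1 ∧ b = a + 2 ∧ d = a + 3 ∧ a ≤ u ∧ u ≤ a + 3) ∨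
      (a = 0 ∧ c % 5 = 4 ∧ b = c + 1 ∧ d = c + 2 ∧ (u = 0 ∨ c ≤ u ∧ u ≤ c + 2)) := by
    intro a c b d u h hu
    unfold Quad at h
    omega
  rcases key h hu with k1 | k1 <;> rcases key h' hu' with k2 | k2 <;>
    have k3 := key h hv <;> have k4 := key h' hv' <;> clear h h' hu hu' hv hv' <;> omega

/-! ### The drawing of the join with a vertex -/

variable {k : ℕ}

/-- The vertices of `G_k` lie on a parabola, the new vertex lies far below it. -/
def chordVert (k : ℕ) : Fin (5 * k + 2) ⊕ Fin 1 → Plane :=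
  Sum.elim (fun a => para (a : ℕ)) fun _ => (0, -((5 * k + 2 : ℕ) : ℝ) ^ 2)

lemma cast_lt (a : Fin (5 * k + 2)) : ((a : ℕ) : ℝ) < (5 * k + 2 : ℕ) := by exact_mod_cast a.2

lemma apex_pos (k : ℕ) : 0 < ((5 * k + 2 : ℕ) : ℝ) ^ 2 := by positivity

lemma mul_lt_apex (a b : Fin (5 * k + 2)) :
    ((a : ℕ) : ℝ) * (b : ℕ) < ((5 * k + 2 : ℕ) : ℝ) ^ 2 := by
  rw [pow_two]
  exact mul_lt_mul'' (cast_lt a) (cast_lt b) (Nat.cast_nonneg _) (Nat.cast_nonneg _)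

lemma sq_lt_apex (a : Fin (5 * k + 2)) : ((a : ℕ) : ℝ) ^ 2 < ((5 * k + 2 : ℕ) : ℝ) ^ 2 := by
  rw [pow_two]; exact mul_lt_apex a a

lemma chordVert_injective : Function.Injective (chordVert k) := by
  have h := apex_pos k
  rintro (a | a) (b | b) hab
  · have := congrArg Prod.fst hab
    simp only [chordVert, Sum.elim_inl, para, Nat.cast_inj] at this
    rw [Fin.ext this]
  · have := congrArg Prod.snd hab
    simp only [chordVert, Sum.elim_inl, Sum.elim_inr, para] at this
    nlinarith [sq_nonneg ((a : ℕ) : ℝ)]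
  · have := congrArg Prod.snd hab
    simp only [chordVert, Sum.elim_inl, Sum.elim_inr, para] at this
    nlinarith [sq_nonneg ((b : ℕ) : ℝ)]
  · rw [Subsingleton.elim a b]

/-- The join of `G_k` with a vertex. -/
abbrev chordJoin (k : ℕ) : SimpleGraph (Fin (5 * k + 2) ⊕ Fin 1) :=
  join (chordGraph k) (SimpleGraph.pathGraph 1)

/-- The edge `ab` of `G_k` as an edge of the join. -/
def chordEdge (a b : Fin (5 * k + 2)) : Sym2 (Fin (5 * k + 2) ⊕ Fin 1) := s(Sum.inl a, Sum.inl b)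

lemma chordJoin_edge (e : (chordJoin k).edgeSet) :
    (∃ a b : Fin (5 * k + 2), ChordRel a b ∧ e.1 = chordEdge a b) ∨
      ∃ a : Fin (5 * k + 2), e.1 = s(Sum.inl a, Sum.inr 0) := by
  obtain ⟨e, he⟩ := e
  induction e using Sym2.ind with
  | _ x y =>
    rw [SimpleGraph.mem_edgeSet] at he
    rcases x with a | a <;> rcases y with b | b
    · left
      rcases he with h | h
      · rcases h with h | h
        · exact ⟨a, b, h, rfl⟩
        · exact ⟨b, a, h, Sym2.eq_swap⟩
      · simp at h
    · right; exact ⟨a, by obtain rfl := Subsingleton.elim b 0; rfl⟩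
    · right; exact ⟨b, by obtain rfl := Subsingleton.elim a 0; exact Sym2.eq_swap⟩
    · exact absurd (congrArg Sum.inr (Subsingleton.elim a b)) he.ne

lemma chordJoin_ends (e : (chordJoin k).edgeSet) :
    ∃ x y, x ≠ y ∧ e.1 = s(x, y) := by
  obtain ⟨e, he⟩ := e
  induction e using Sym2.ind with
  | _ x y => exact ⟨x, y, ((SimpleGraph.mem_edgeSet _).1 he).ne, rfl⟩

/-- The segment representing an edge. -/
noncomputable def chordArc (e : (chordJoin k).edgeSet) : PolygonalArc :=
  segmentArc (chordVert k (chordJoin_ends e).choose)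
    (chordVert k (chordJoin_ends e).choose_spec.choose)
    fun h => (chordJoin_ends e).choose_spec.choose_spec.1 (chordVert_injective h)

lemma chordArc_ends (e : (chordJoin k).edgeSet) :
    s((chordArc e).source, (chordArc e).target) = Sym2.map (chordVert k) e.1 := by
  conv_rhs => rw [(chordJoin_ends e).choose_spec.choose_spec.2]
  rfl

lemma chordArc_eq {e : (chordJoin k).edgeSet} {x y : Fin (5 * k + 2) ⊕ Fin 1}
    (h : e.1 = s(x, y)) :
    (chordArc e).carrier = segment ℝ (chordVert k x) (chordVert k y) ∧
    (chordArc e).inner = openSegment ℝ (chordVert k x) (chordVert k y) := by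
  rw [chordArc, segmentArc_carrier, segmentArc_inner]
  have h2 := h.symm.trans (chordJoin_ends e).choose_spec.choose_spec.2
  rw [Sym2.eq_iff] at h2
  rcases h2 with ⟨h1, h2⟩ | ⟨h1, h2⟩
  · rw [h1, h2]; exact ⟨rfl, rfl⟩
  · rw [h1, h2]; exact ⟨segment_symm _ _ _, openSegment_symm _ _ _⟩

lemma chordArc_chord {e : (chordJoin k).edgeSet} {a b : Fin (5 * k + 2)}
    (h : e.1 = chordEdge a b) :
    (chordArc e).carrier = segment ℝ (para (a : ℕ)) (para (b : ℕ)) ∧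
    (chordArc e).inner = openSegment ℝ (para (a : ℕ)) (para (b : ℕ)) := chordArc_eq h

lemma chordArc_spoke {e : (chordJoin k).edgeSet} {a : Fin (5 * k + 2)}
    (h : e.1 = s(Sum.inl a, Sum.inr 0)) :
    (chordArc e).inner = openSegment ℝ (para (a : ℕ)) (0, -((5 * k + 2 : ℕ) : ℝ) ^ 2) :=
  (chordArc_eq h).2

lemma chordVert_notMem (e : (chordJoin k).edgeSet) (v : Fin (5 * k + 2) ⊕ Fin 1) :
    chordVert k v ∉ (chordArc e).inner := by
  intro hv
  have hk := apex_pos k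
  rcases chordJoin_edge e with ⟨a, b, hab, he⟩ | ⟨a, he⟩
  · rw [(chordArc_chord he).2] at hv
    have := sq_lt_of_mem_openSegment_para (Nat.cast_lt.2 hab.lt) hv
    rcases v with v | v
    · exact lt_irrefl _ this
    · simp only [chordVert, Sum.elim_inr] at this; nlinarith
  · rw [chordArc_spoke he] at hv
    have := lt_sq_of_mem_openSegment_apex (sq_lt_apex a) hv
    rcases v with v | v
    · exact lt_irrefl _ this.1
    · exact lt_irrefl _ this.2

/-- The only crossings are those of the diagonals of the quadrilaterals. -/
lemma exists_quad {e f : (chordJoin k).edgeSet} (hef : e ≠ f) {p : Plane}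
    (he : p ∈ (chordArc e).inner) (hf : p ∈ (chordArc f).inner) :
    ∃ a c b d : Fin (5 * k + 2), Quad a c b d ∧
      (e.1 = chordEdge a b ∧ f.1 = chordEdge c d ∨ e.1 = chordEdge c d ∧ f.1 = chordEdge a b) := by
  have hne : e.1 ≠ f.1 := fun h => hef (Subtype.ext h)
  rcases chordJoin_edge e with ⟨a, b, hab, hea⟩ | ⟨a, hea⟩ <;>
    rcases chordJoin_edge f with ⟨c, d, hcd, hfc⟩ | ⟨c, hfc⟩
  · rw [(chordArc_chord hea).2] at he
    rw [(chordArc_chord hfc).2] at hf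
    have h := interleaved_of_mem (Nat.cast_lt.2 hab.lt) (Nat.cast_lt.2 hcd.lt) he hf (by
      rintro ⟨h1, h2⟩
      apply hne
      rw [hea, hfc, Fin.ext (Nat.cast_injective h1), Fin.ext (Nat.cast_injective h2)])
    simp only [Nat.cast_lt] at h
    rcases h with ⟨h1, h2, h3⟩ | ⟨h1, h2, h3⟩
    · exact ⟨a, c, b, d, quad_of_interleaved hab hcd h1 h2 h3, Or.inl ⟨hea, hfc⟩⟩
    · exact ⟨c, a, d, b, quad_of_interleaved hcd hab h1 h2 h3, Or.inr ⟨hea, hfc⟩⟩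
  · rw [(chordArc_chord hea).2] at he
    rw [chordArc_spoke hfc] at hf
    have h1 := sq_lt_of_mem_openSegment_para (Nat.cast_lt.2 hab.lt) he
    have h2 := lt_sq_of_mem_openSegment_apex (sq_lt_apex c) hf
    exact absurd (h1.trans h2.1) (lt_irrefl _)
  · rw [(chordArc_chord hfc).2] at hf
    rw [chordArc_spoke hea] at he
    have h1 := sq_lt_of_mem_openSegment_para (Nat.cast_lt.2 hcd.lt) hf
    have h2 := lt_sq_of_mem_openSegment_apex (sq_lt_apex a) he
    exact absurd (h1.trans h2.1) (lt_irrefl _)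
  · rw [chordArc_spoke hea] at he
    rw [chordArc_spoke hfc] at hf
    have := eq_of_mem_apex (mul_lt_apex a c) he hf
    exact absurd (by rw [hea, hfc, Fin.ext (Nat.cast_injective this)]) hne

lemma chordEdge_eq_iff {a b c d : Fin (5 * k + 2)} :
    chordEdge a b = chordEdge c d ↔
      (a : ℕ) = c ∧ (b : ℕ) = d ∨ (a : ℕ) = d ∧ (b : ℕ) = c := by
  simp [chordEdge, Fin.ext_iff]

lemma Quad.sum_ne {a c b d : ℕ} (h : Quad a c b d) :
    a < b ∧ c < d ∧ (a : ℝ) + b ≠ c + d := by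
  have : a < b ∧ c < d ∧ a + b < c + d := by unfold Quad at h; omega
  refine ⟨this.1, this.2.1, ne_of_lt ?_⟩
  exact_mod_cast this.2.2

lemma eq_of_mem_chordArcs {e f : (chordJoin k).edgeSet} (hef : e ≠ f) {p q : Plane}
    (hp : p ∈ (chordArc e).inner) (hp' : p ∈ (chordArc f).inner) (hq : q ∈ (chordArc e).inner)
    (hq' : q ∈ (chordArc f).inner) : p = q := by
  obtain ⟨a, c, b, d, hQ, h⟩ := exists_quad hef hp hp'
  obtain ⟨hab, hcd, hs⟩ := hQ.sum_ne
  rcases h with ⟨he, hf⟩ | ⟨he, hf⟩ <;>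
    rw [(chordArc_chord he).2] at hp hq <;> rw [(chordArc_chord hf).2] at hp' hq'
  · exact eq_of_mem_para (Nat.cast_lt.2 hab) (Nat.cast_lt.2 hcd) hs hp hp' hq hq'
  · exact eq_of_mem_para (Nat.cast_lt.2 hab) (Nat.cast_lt.2 hcd) hs hp' hp hq' hq

/-- The drawing of the join. -/
noncomputable def chordDrawing (k : ℕ) : OnePlanarDrawing (chordJoin k) where
  vert := chordVert k
  vert_injective := chordVert_injective
  arc := chordArc
  arc_ends := chordArc_ends
  vert_not_mem_inner := chordVert_notMem
  proper e f hef p := by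
    rintro ⟨hp, hp'⟩
    obtain ⟨a, c, b, d, hQ, h⟩ := exists_quad hef hp hp'
    obtain ⟨hab, hcd, hs⟩ := hQ.sum_ne
    rcases h with ⟨he, hf⟩ | ⟨he, hf⟩ <;>
      rw [(chordArc_chord he).2] at hp <;> rw [(chordArc_chord hf).2] at hp' <;>
      rw [(chordArc_chord he).1, (chordArc_chord hf).1]
    · exact passesThrough_para (Nat.cast_lt.2 hab) (Nat.cast_lt.2 hcd) hs hp hp'
    · exact passesThrough_para (Nat.cast_lt.2 hcd) (Nat.cast_lt.2 hab) hs.symm hp hp'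
  adjacent_not_cross e f hef := by
    rintro ⟨v, hve, hvf⟩
    rw [Set.disjoint_left]
    intro p hp hp'
    obtain ⟨a, c, b, d, hQ, h⟩ := exists_quad hef hp hp'
    have hne : (a : ℕ) ≠ c ∧ (a : ℕ) ≠ d ∧ (b : ℕ) ≠ c ∧ (b : ℕ) ≠ d := by
      unfold Quad at hQ; omega
    simp only [ne_eq, ← Fin.ext_iff] at hne
    rcases h with ⟨he, hf⟩ | ⟨he, hf⟩ <;> rw [he, chordEdge, Sym2.mem_iff] at hve <;>
      rw [hf, chordEdge, Sym2.mem_iff] at hvf <;> rcases hve with rfl | rfl <;>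
      simp only [Sum.inl.injEq] at hvf <;> grind
  crossed_at_most_once e f g hfe hge p := by
    rintro ⟨hp, hp'⟩ q ⟨hq, hq'⟩
    have hfg : f = g := by
      obtain ⟨a, c, b, d, hQ, h⟩ := exists_quad hfe.symm hp hp'
      obtain ⟨a', c', b', d', hQ', h'⟩ := exists_quad hge.symm hq hq'
      apply Subtype.ext
      unfold Quad at hQ hQ'
      rcases h with ⟨he, hf⟩ | ⟨he, hf⟩ <;> rcases h' with ⟨he', hg⟩ | ⟨he', hg⟩ <;>
        rw [he, chordEdge_eq_iff] at he' <;> rw [hf, hg, chordEdge_eq_iff] <;> omega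
    subst hfg
    exact ⟨rfl, eq_of_mem_chordArcs hfe.symm hp hp' hq hq'⟩

/-- The neighbours of a crossing are corners of its quadrilateral. Two crossings with two common
neighbours therefore belong to the same quadrilateral, whose diagonals meet only once. -/
lemma chordDrawing_commonNeighborsLE (k : ℕ) : (chordDrawing k).CommonNeighborsLE 1 := by
  have key : ∀ c : (chordDrawing k).crossings, ∃ a x b y : Fin (5 * k + 2), Quad a x b y ∧
      (∃ e f : (chordJoin k).edgeSet, e ≠ f ∧ e.1 = chordEdge a b ∧ f.1 = chordEdge x y ∧
        (c : Plane) ∈ (chordArc e).inner ∧ (c : Plane) ∈ (chordArc f).inner) ∧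
      ∀ v ∈ (chordDrawing k).associatedGraph.neighborSet (Sum.inr c),
        ∃ u : Fin (5 * k + 2), v = Sum.inl (Sum.inl u) ∧
          ((u : ℕ) = a ∨ (u : ℕ) = x ∨ (u : ℕ) = b ∨ (u : ℕ) = y) := by
    rintro ⟨p, e, f, hef, hpe, hpf⟩
    obtain ⟨a, x, b, y, hQ, h⟩ := exists_quad hef hpe hpf
    refine ⟨a, x, b, y, hQ, ?_, ?_⟩
    · rcases h with ⟨he, hf⟩ | ⟨he, hf⟩
      · exact ⟨e, f, hef, he, hf, hpe, hpf⟩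
      · exact ⟨f, e, hef.symm, hf, he, hpf, hpe⟩
    · rintro (v | c) hv
      · obtain ⟨g, hvg, hpg⟩ := hv
        have hg : g = e ∨ g = f := by
          by_contra hcon
          push Not at hcon
          exact hef ((chordDrawing k).crossed_at_most_once g e f hcon.1.symm hcon.2.symm p
            ⟨hpg, hpe⟩ p ⟨hpg, hpf⟩).1
        have : v = Sum.inl a ∨ v = Sum.inl x ∨ v = Sum.inl b ∨ v = Sum.inl y := by
          rcases h with ⟨he, hf⟩ | ⟨he, hf⟩ <;> rcases hg with rfl | rfl <;>
            (first | rw [he, chordEdge, Sym2.mem_iff] at hvg |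
              rw [hf, chordEdge, Sym2.mem_iff] at hvg) <;> tauto
        rcases this with rfl | rfl | rfl | rfl
        · exact ⟨a, rfl, by simp⟩
        · exact ⟨x, rfl, by simp⟩
        · exact ⟨b, rfl, by simp⟩
        · exact ⟨y, rfl, by simp⟩
      · exact hv.elim
  intro c₁ c₂ hne
  rw [Nat.cast_one, encard_le_one_iff]
  rintro v w ⟨hv₁, hv₂⟩ ⟨hw₁, hw₂⟩
  by_contra hvw
  obtain ⟨a, x, b, y, hQ, ⟨e, f, hef, he, hf, hce, hcf⟩, hN⟩ := key c₁
  obtain ⟨a', x', b', y', hQ', ⟨e', f', hef', he', hf', hce', hcf'⟩, hN'⟩ := key c₂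
  obtain ⟨u, rfl, hu⟩ := hN v hv₁
  obtain ⟨u', h1, hu'⟩ := hN' _ hv₂
  obtain ⟨t, rfl, ht⟩ := hN w hw₁
  obtain ⟨t', h2, ht'⟩ := hN' _ hw₂
  obtain rfl : u = u' := Sum.inl_injective (Sum.inl_injective h1)
  obtain rfl : t = t' := Sum.inl_injective (Sum.inl_injective h2)
  obtain ⟨h1, h2, h3, h4⟩ := hQ.eq_of_common hQ' hu hu' ht ht'
    fun h => hvw (by rw [Fin.ext h])
  obtain rfl : a = a' := Fin.ext h1
  obtain rfl : x = x' := Fin.ext h2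
  obtain rfl : b = b' := Fin.ext h3
  obtain rfl : y = y' := Fin.ext h4
  obtain rfl : e = e' := Subtype.ext (he.trans he'.symm)
  obtain rfl : f = f' := Subtype.ext (hf.trans hf'.symm)
  exact hne (Subtype.ext (eq_of_mem_chordArcs hef hce hcf hce' hcf'))

/-- The join has `5k + 3` vertices and at least `17k + 3` edges, and `13(5k + 3) < 4(17k + 3) + 24`
holds exactly when `k > 1`. -/
theorem isClassC1_chordJoin {k : ℕ} (hk : 2 ≤ k) : IsClassC1 (chordJoin k) := by
  refine ⟨not_isClassC0 _ ?_ ?_, chordDrawing k, chordDrawing_commonNeighborsLE k⟩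
  · rw [Nat.card_sum, Nat.card_fin, Nat.card_fin]; omega
  · have h : _ ≤ Nat.card (chordJoin k).edgeSet := card_join_edgeSet (chordGraph k)
    rw [Nat.card_coe_set_eq, ncard_chordGraph, Nat.card_fin] at h
    rw [Nat.card_sum, Nat.card_fin, Nat.card_fin]
    omega

end OnePlanar

theorem mainTheorem9 :
    (∀ (V : Type*) [Finite V] (G : SimpleGraph V),
      OnePlanar.IsClassC1 (OnePlanar.join G (SimpleGraph.pathGraph 1)) →
        (G.edgeSet.ncard : ℝ) ≤ 2.6 * (Nat.card V : ℝ) - 3.6) ∧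
    (∀ k : ℕ, 2 ≤ k → ∃ G : SimpleGraph (Fin (5 * k + 2)),
      G.edgeSet.ncard = 12 * k + 1 ∧
      (G.edgeSet.ncard : ℝ) = 2.4 * (Nat.card (Fin (5 * k + 2)) : ℝ) - 3.8 ∧
      OnePlanar.IsClassC1 (OnePlanar.join G (SimpleGraph.pathGraph 1))) := by
  refine ⟨fun V _ G h => ?_, fun k hk => ⟨OnePlanar.chordGraph k, OnePlanar.ncard_chordGraph k, ?_,
    OnePlanar.isClassC1_chordJoin hk⟩⟩
  · have := OnePlanar.card_edges_le_of_isClassC1 G h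
    rw [Nat.card_coe_set_eq] at this
    have : (5 * G.edgeSet.ncard + 18 : ℝ) ≤ 13 * Nat.card V := by exact_mod_cast this
    linarith
  · rw [OnePlanar.ncard_chordGraph, Nat.card_fin]
    push_cast
    ring
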